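/- **Theorem.** Consider the plant $$\dot x=Ax+Bu+Ep(q)+E_ww,\qquad y=Cx+Du+F_ww,\qquad q=C_qx,$$ with constant real matrices, $x\in\mathbb R^{n_x}$, $u\in\mathbb R^{n_u}$, $y\in\mathbb R^{n_y}$, $q\in\mathbb R^{n_q}$, $w\in\mathbb R^{n_w}$. Assume that there is no measurement noise, $F_w=0$, that $p:\mathbb R^{n_q}\to\mathbb R^{n_p}$ is globally Lipschitz with $p(0)=0$, and that $p$ has an incremental multiplier matrix, i.e. a symmetric matrix $M$ with $\begin{pmatrix}\delta q\\ \delta p\end{pmatrix}^{\!\top}M\begin{pmatrix}\delta q\\ \delta p\end{pmatrix}\ge 0$ for all $q_1,q_2$, where $\delta q=q_2-q_1$, $\delta p=p(q_2)-p(q_1)$. Let the observer be $$\dot{\hat x}=A\hat x+Bu+Ep\big(C_q\hat x+L_1(\hat y-y)\big)+L_2(\hat y-y),\qquad \hat y=C\hat x+Du,$$ let $k(x)=K_1x+K_2p(C_qx)$, $e=x-\hat x$ and $z=(x,e)$. Let $\|\cdot\|$ be the Euclidean norm, and let $\omega_0>0$ be arbitrary. Suppose that there are $\alpha_0>0$,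 a symmetric positive definite matrix $P$ and gains $K_1,K_2,L_1,L_2$ such that $V(z)=z^\top Pz$ satisfies $\dot V\le-\alpha_0V$ along the closed loop with the continuous-time controller $u=k(\hat x)$ when $w\equiv0$ (that is, $\nabla V(z)\cdot f(z)\le -\alpha_0V(z)$ for every $z$, where $\dot z=f(z)$ is this closed loop). Now let the controller be event-triggered: $u(t)=k(\hat x_s(t))$ with $\hat x_s(t)=\hat x(t_k)$ for $t\in[t_k,t_{k+1})$, $t_0=0$, and $$t_{k+1}=\inf\{t\ge t_k+\tau:\ \|\hat x(t_k)-\hat x(t)\|>\sigma\|\hat x(t)\|+\epsilon\}\in(t_k,\infty],$$ where, in this rule, $\hat x(t)$, $t\ge t_k$, is computed with the sample $\hat x_s=\hat x(t_k)$ held. Then there are $\tau,\sigma,\epsilon>0$ such that, for disturbances $w$ on $[0,\infty)$ that are measurable with $\|w\|_\infty=\operatorname{ess\,sup}_{t\ge0}\|w(t)\|\le\omega_0$, the following hold. 1. The event-triggered closed loop is input-to-state practically stable with respect to $w$: there are $\beta_1\in\mathcal{KL}$, $\beta_2\in\mathcal K$ and $d\ge0$ such that for every such $w$ there is, from every initial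 state, a trajectory on $[0,\infty)$, and every trajectory satisfies $$\|z(t)\|\le\beta_1(\|z(0)\|,t)+\beta_2(\|w\|_\infty)+d\qquad\text{for all }t\ge0.$$ 2. $V$ is an ISpS-Lyapunov function of the event-triggered closed loop in the implication form: $V$ is smooth, positive definite and radially unbounded, and there are a continuous positive definite function $\gamma:[0,\infty)\to[0,\infty)$, a function $\chi\in\mathcal K$ and a constant $d'\ge0$ such that, along every trajectory under every such $w$ and at every $t\ge0$, $$\|z(t)\|\ge\chi(\|w(t)\|)+d'\ \Longrightarrow\ \nabla V(z(t))\cdot f_s\big(z(t),\hat x_s(t),w(t)\big)\le-\gamma(\|z(t)\|),$$ where $\dot z=f_s(z,\hat x_s,w)$ is the equation of the event-triggered closed loop. Here $\mathcal K$ is the class of continuous strictly increasing functions $[0,\infty)\to[0,\infty)$ that vanish at $0$, and $\mathcal{KL}$ is the class of continuous $\beta:[0,\infty)^2\to[0,\infty)$ such that $\beta(\cdot,s)\in\mathcal K$ and is unbounded for every $s$, and $\beta(r,\cdot)$ is non-increasing with limit $0$ at infinity for every $r$. -/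

import Mathlib

open MeasureTheory Filter Topology
open scoped NNReal ENNReal ContDiff Matrix

/-- The Euclidean space `ℝⁿ` with the `2`-norm. -/
abbrev Vec (n : ℕ) : Type := EuclideanSpace ℝ (Fin n)

/-- The space of `z = (x, e)` with `x, e ∈ ℝⁿ`, with the `2`-norm. -/
abbrev PairVec (n : ℕ) : Type := EuclideanSpace ℝ (Fin n ⊕ Fin n)

/-- Matrix times vector, on Euclidean spaces. -/
noncomputable def matVec {m n : Type*} [Fintype n]
    (A : Matrix m n ℝ) (v : EuclideanSpace ℝ n) : EuclideanSpace ℝ m :=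
  WithLp.toLp 2 (A *ᵥ v.ofLp)

infixr:73 " ⬝ₑ " => matVec

/-! ### Comparison functions -/

/-- Class `𝒦`: continuous, strictly increasing, zero at zero. -/
structure IsClassK (f : ℝ≥0 → ℝ≥0) : Prop where
  continuous : Continuous f
  strictMono : StrictMono f
  map_zero : f 0 = 0

/-- Class `𝒦_∞`: class `𝒦` and unbounded. -/
structure IsClassKInf (f : ℝ≥0 → ℝ≥0) : Prop extends IsClassK f where
  tendsto_atTop : Tendsto f atTop atTop

/-- Class `𝒦ℒ`: jointly continuous, of class `𝒦_∞` in the first argument, decreasing to `0` in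
the second one (weakly decreasing, as it vanishes identically when the first argument is `0`). -/
structure IsClassKL (f : ℝ≥0 → ℝ≥0 → ℝ≥0) : Prop where
  continuous : Continuous (Function.uncurry f)
  classKInf : ∀ s, IsClassKInf (fun r => f r s)
  antitone : ∀ r, Antitone (f r)
  tendsto_zero : ∀ r, Tendsto (f r) atTop (𝓝 0)

/-- A continuous positive definite function on `[0, ∞)`. -/
structure IsPosDefFun (f : ℝ≥0 → ℝ≥0) : Prop where
  continuous : Continuous f
  map_zero : f 0 = 0
  pos : ∀ r, 0 < r → 0 < f r

/-! ### Inputs and input-to-state practical stability -/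

/-- The (essential) supremum norm of a signal on `[0, ∞)`. -/
noncomputable def signalNorm {n : ℕ} (w : ℝ → Vec n) : ℝ≥0 :=
  (eLpNorm w ∞ (volume.restrict (Set.Ici (0 : ℝ)))).toNNReal

/-- The measurable, essentially bounded signals on `[0, ∞)` whose norm is at most `ω₀`. -/
def boundedSignals (n : ℕ) (ω₀ : ℝ) : Set (ℝ → Vec n) :=
  {w | MemLp w ∞ (volume.restrict (Set.Ici (0 : ℝ))) ∧ (signalNorm w : ℝ) ≤ ω₀}

/-- Input-to-state practical stability, for inputs in the class `𝒲`, of a system given by its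
trajectories: `Traj w z` means that `z` is a trajectory on `[0, ∞)` under the input `w`.
All trajectories exist on `[0, ∞)` and obey one common estimate. -/
def IsISpS {n : ℕ} {Z : Type*} [NormedAddCommGroup Z]
    (Traj : (ℝ → Vec n) → (ℝ → Z) → Prop) (𝒲 : Set (ℝ → Vec n)) : Prop :=
  ∃ (β₁ : ℝ≥0 → ℝ≥0 → ℝ≥0) (β₂ : ℝ≥0 → ℝ≥0) (d : ℝ≥0), IsClassKL β₁ ∧ IsClassK β₂ ∧
    ∀ w ∈ 𝒲,
      (∀ z₀ : Z, ∃ z : ℝ → Z, Traj w z ∧ z 0 = z₀) ∧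
      ∀ z : ℝ → Z, Traj w z →
        ∀ t : ℝ≥0, ‖z t‖₊ ≤ β₁ ‖z 0‖₊ t + β₂ (signalNorm w) + d

/-! ### The plant, the observer and the controller -/

/-- The data of the plant `ẋ = A x + B u + E p(q) + E_w w`, `y = C x + D u + F_w w`,
`q = C_q x`. -/
structure Plant (nx nu ny nq np nw : ℕ) where
  A : Matrix (Fin nx) (Fin nx) ℝ
  B : Matrix (Fin nx) (Fin nu) ℝ
  C : Matrix (Fin ny) (Fin nx) ℝ
  D : Matrix (Fin ny) (Fin nu) ℝ
  E : Matrix (Fin nx) (Fin np) ℝ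
  Cq : Matrix (Fin nq) (Fin nx) ℝ
  Ew : Matrix (Fin nx) (Fin nw) ℝ
  Fw : Matrix (Fin ny) (Fin nw) ℝ
  p : Vec nq → Vec np

/-- The observer gains `L₁, L₂` and the controller gains `K₁, K₂`. -/
structure Gains (nx nu ny nq np : ℕ) where
  K₁ : Matrix (Fin nu) (Fin nx) ℝ
  K₂ : Matrix (Fin nu) (Fin np) ℝ
  L₁ : Matrix (Fin nq) (Fin ny) ℝ
  L₂ : Matrix (Fin nx) (Fin ny) ℝ

/-- `M` is an incremental multiplier matrix for `p`. -/
def IsIncrementalMultiplier {nq np : ℕ} (p : Vec nq → Vec np)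
    (M : Matrix (Fin nq ⊕ Fin np) (Fin nq ⊕ Fin np) ℝ) : Prop :=
  M.IsSymm ∧ ∀ q₁ q₂ : Vec nq,
    0 ≤ Sum.elim (q₂ - q₁).ofLp (p q₂ - p q₁).ofLp ⬝ᵥ
      (M *ᵥ Sum.elim (q₂ - q₁).ofLp (p q₂ - p q₁).ofLp)

/-- The component `x` of `z = (x, e)`. -/
def plantState {n : ℕ} (z : PairVec n) : Vec n := WithLp.toLp 2 fun i => z (Sum.inl i)

/-- The component `e` of `z = (x, e)`. -/
def estError {n : ℕ} (z : PairVec n) : Vec n := WithLp.toLp 2 fun i => z (Sum.inr i)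

/-- The vector `(x, e)`. -/
def pair {n : ℕ} (x e : Vec n) : PairVec n := WithLp.toLp 2 (Sum.elim x.ofLp e.ofLp)

/-- The observer state `x̂ = x - e`, read off from `z = (x, e)`. -/
def observerState {n : ℕ} (z : PairVec n) : Vec n := plantState z - estError z

section ClosedLoop

variable {nx nu ny nq np nw : ℕ}

/-- The right-hand side of the plant equation. -/
noncomputable def Plant.stateField (S : Plant nx nu ny nq np nw)
    (x : Vec nx) (u : Vec nu) (w : Vec nw) : Vec nx :=
  S.A ⬝ₑ x + S.B ⬝ₑ u + S.E ⬝ₑ S.p (S.Cq ⬝ₑ x) + S.Ew ⬝ₑ w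

/-- The measured output `y`. -/
noncomputable def Plant.output (S : Plant nx nu ny nq np nw)
    (x : Vec nx) (u : Vec nu) (w : Vec nw) : Vec ny :=
  S.C ⬝ₑ x + S.D ⬝ₑ u + S.Fw ⬝ₑ w

/-- The right-hand side of the observer equation
`x̂' = A x̂ + B u + E p(C_q x̂ + L₁ (ŷ - y)) + L₂ (ŷ - y)`, where `ŷ = C x̂ + D u`. -/
noncomputable def Plant.observerField (S : Plant nx nu ny nq np nw) (G : Gains nx nu ny nq np)
    (xh : Vec nx) (u : Vec nu) (y : Vec ny) : Vec nx :=
  S.A ⬝ₑ xh + S.B ⬝ₑ u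
    + S.E ⬝ₑ S.p (S.Cq ⬝ₑ xh + G.L₁ ⬝ₑ ((S.C ⬝ₑ xh + S.D ⬝ₑ u) - y))
    + G.L₂ ⬝ₑ ((S.C ⬝ₑ xh + S.D ⬝ₑ u) - y)

/-- The feedback law `k(x) = K₁ x + K₂ p(C_q x)`. -/
noncomputable def Plant.feedback (S : Plant nx nu ny nq np nw) (G : Gains nx nu ny nq np)
    (x : Vec nx) : Vec nu :=
  G.K₁ ⬝ₑ x + G.K₂ ⬝ₑ S.p (S.Cq ⬝ₑ x)

/-- The right-hand side of the equation for `z = (x, x - x̂)` when plant and observer are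
interconnected and the input is `u`. -/
noncomputable def Plant.pairField (S : Plant nx nu ny nq np nw) (G : Gains nx nu ny nq np)
    (u : Vec nu) (z : PairVec nx) (w : Vec nw) : PairVec nx :=
  pair (S.stateField (plantState z) u w)
    (S.stateField (plantState z) u w
      - S.observerField G (observerState z) u (S.output (plantState z) u w))

/-- The closed loop with the continuous-time controller `u = k(x̂)`. -/
noncomputable def Plant.continuousField (S : Plant nx nu ny nq np nw)
    (G : Gains nx nu ny nq np) (z : PairVec nx) (w : Vec nw) : PairVec nx :=
  S.pairField G (S.feedback G (observerState z)) z w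

/-- The closed loop with the sampled controller `u = k(x̂ₛ)`. -/
noncomputable def Plant.sampledField (S : Plant nx nu ny nq np nw)
    (G : Gains nx nu ny nq np) (xs : Vec nx) (z : PairVec nx) (w : Vec nw) : PairVec nx :=
  S.pairField G (S.feedback G xs) z w

/-! ### The event-triggered closed loop -/

/-- `ζ` solves, on `[s, ∞)` and in the sense of Carathéodory, the closed loop in which the
controller uses for ever the sample `x̂ₛ = x̂(s)` taken at time `s`. -/
def Plant.IsHeldSolution (S : Plant nx nu ny nq np nw) (G : Gains nx nu ny nq np)
    (w : ℝ → Vec nw) (s : ℝ) (ζ : ℝ → PairVec nx) : Prop :=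
  ContinuousOn ζ (Set.Ici s) ∧
    ∀ t, s ≤ t → ζ t = ζ s + ∫ r in s..t, S.sampledField G (observerState (ζ s)) (ζ r) (w r)

/-- The triggering rule
`inf {t | t ≥ s + τ, ‖x̂(s) - x̂(t)‖ > σ ‖x̂(t)‖ + ε}`, which is `∞` if there is no such `t`. -/
noncomputable def nextTrigger (τ σ ε s : ℝ) (ζ : ℝ → PairVec nx) : EReal :=
  sInf ((fun t : ℝ => (t : EReal)) ''
    {t : ℝ | s + τ ≤ t ∧
      σ * ‖observerState (ζ t)‖ + ε < ‖observerState (ζ s) - observerState (ζ t)‖})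

/-- `z` is a trajectory on `[0, ∞)` of the event-triggered closed loop, with triggering times
`0 = T 0 < T 1 < …`; the value `∞` means that the controller is not updated any more.
After the time `T k` the state follows the solution `ζ` with the sample `x̂(T k)` held, and
`T (k + 1)` is the time at which the triggering rule fires along `ζ`. -/
structure Plant.IsTriggeredTrajectory (S : Plant nx nu ny nq np nw) (G : Gains nx nu ny nq np)
    (τ σ ε : ℝ) (w : ℝ → Vec nw) (T : ℕ → EReal) (z : ℝ → PairVec nx) : Prop where
  start : T 0 = 0
  stop_of_top : ∀ k, T k = ⊤ → T (k + 1) = ⊤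
  step : ∀ (k : ℕ) (s : ℝ), T k = (s : EReal) →
    ∃ ζ : ℝ → PairVec nx, S.IsHeldSolution G w s ζ ∧
      T (k + 1) = nextTrigger τ σ ε s ζ ∧
      ∀ t : ℝ, s ≤ t → (t : EReal) ≤ T (k + 1) → z t = ζ t

/-! ### Quadratic Lyapunov functions -/

/-- `V(z) = zᵀ P z`. -/
noncomputable def quadForm {n : ℕ} (P : Matrix (Fin n ⊕ Fin n) (Fin n ⊕ Fin n) ℝ)
    (z : PairVec n) : ℝ :=
  z.ofLp ⬝ᵥ (P *ᵥ z.ofLp)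

/-- The derivative `∇V(z) v` of `V` at `z` along the vector `v`. -/
noncomputable def derivAlong {Z : Type*} [NormedAddCommGroup Z] [NormedSpace ℝ Z]
    (V : Z → ℝ) (z v : Z) : ℝ :=
  fderiv ℝ V z v

/-- `V` is an ISpS-Lyapunov function, in the implication form, of the event-triggered closed loop
with inputs in `𝒲`: whenever `‖z‖ ≥ χ(‖w‖) + d`, one has `V̇ ≤ -γ(‖z‖)`. On `[T k, T (k + 1))`
the sample used by the controller is `x̂(T k)`. -/
def Plant.IsISpSLyapunov (S : Plant nx nu ny nq np nw) (G : Gains nx nu ny nq np)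
    (τ σ ε : ℝ) (𝒲 : Set (ℝ → Vec nw)) (V : PairVec nx → ℝ) : Prop :=
  ContDiff ℝ ∞ V ∧ V 0 = 0 ∧ (∀ z, z ≠ 0 → 0 < V z) ∧
    Tendsto V (Bornology.cobounded (PairVec nx)) atTop ∧
    ∃ (γ χ : ℝ≥0 → ℝ≥0) (d : ℝ≥0), IsPosDefFun γ ∧ IsClassK χ ∧
      ∀ w ∈ 𝒲, ∀ (T : ℕ → EReal) (z : ℝ → PairVec nx),
        S.IsTriggeredTrajectory G τ σ ε w T z →
        ∀ (k : ℕ) (s t : ℝ), T k = (s : EReal) → s ≤ t → (t : EReal) < T (k + 1) →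
          χ ‖w t‖₊ + d ≤ ‖z t‖₊ →
          derivAlong V (z t) (S.sampledField G (observerState (z s)) (z t) (w t))
            ≤ -(γ ‖z t‖₊ : ℝ)

end ClosedLoop

/-! ### Integral equations with a Lipschitz field and a bounded forcing term -/

section IntegralEquation

variable {Z : Type*} [NormedAddCommGroup Z] [NormedSpace ℝ Z]

/-! The event-triggered loop is a small perturbation of the exponentially stable continuous-time
loop. Since `S.Fw = 0`, the sampled field is the continuous one plus $b(\hat x_s)-b(\hat x)$ plus a
linear term $Jw$, where $b$ (`actuation`) is Lipschitz with constant $L_b$. Hence $\dot V\le-\alpha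
V+2\|P\|\,\|z\|\,(L_b\|\hat x_s-\hat x\|+\|J\|\,\|w\|)$.

The sampling error $\hat x_s-\hat x$ is controlled in two regimes. After the dwell time, the rule
has not fired, so the error is at most $\sigma\|\hat x\|+\epsilon$. During the dwell time, the state
has moved by only $O(\tau)(\|z\|+\|w\|_\infty)$. With $l\|z\|^2\le V$, small $\tau$ and $\sigma$
make the part of the perturbation that is quadratic in $\|z\|$ at most $\alpha l\|z\|^2/4$. What
remains is linear in $\|z\|$; this is `DecaysBetweenTriggers`, from which both claims follow.

For the trajectory estimate, Young's inequality turns the linear term into a constant, so $\dot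
V\le-\frac{\alpha}{2}(V-D)$ almost everywhere, and a Gronwall argument is chained over the sampling
intervals. For the Lyapunov implication, the linear term is dominated by the quadratic one once
$\|z\|$ is large; there $\|w\|_\infty$ is replaced by $\omega_0$ and goes into the constant $d'$.

Trajectories exist globally because the held field is Lipschitz up to the bounded forcing $Jw$, and
the dwell time excludes accumulation of triggering times. -/

theorem integral_exp_mul_sub {Λ : ℝ} (hΛ : Λ ≠ 0) (s t : ℝ) :
    ∫ r in s..t, Real.exp (Λ * (r - s)) = (Real.exp (Λ * (t - s)) - 1) / Λ := by
  have h : ∀ r ∈ Set.uIcc s t,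
      HasDerivAt (fun r => Real.exp (Λ * (r - s)) / Λ) (Real.exp (Λ * (r - s))) r := by
    intro r _
    have h1 : HasDerivAt (fun r : ℝ => Λ * (r - s)) (Λ * 1) r :=
      ((hasDerivAt_id r).sub_const s).const_mul Λ
    convert! h1.exp.div_const Λ using 1
    field_simp
  rw [intervalIntegral.integral_eq_sub_of_hasDerivAt h
    (Continuous.intervalIntegrable (by fun_prop) _ _)]
  simp
  ring

/-- A function dominated by `C exp (Λ (r - s))` has, after weighting with `exp (-Λ (t - s))`,
a primitive bounded by `C / Λ`. -/
theorem norm_exp_smul_integral_le {f : ℝ → Z} {s t C Λ : ℝ} (hst : s ≤ t) (hC : 0 ≤ C)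
    (hΛ : 0 < Λ) (hf : ∀ᵐ r, r ∈ Set.Ioc s t → ‖f r‖ ≤ C * Real.exp (Λ * (r - s))) :
    ‖Real.exp (-(Λ * (t - s))) • ∫ r in s..t, f r‖ ≤ C / Λ := by
  have h1 : ‖∫ r in s..t, f r‖ ≤ ∫ r in s..t, C * Real.exp (Λ * (r - s)) :=
    intervalIntegral.norm_integral_le_of_norm_le hst hf
      (Continuous.intervalIntegrable (by fun_prop) _ _)
  rw [intervalIntegral.integral_const_mul, integral_exp_mul_sub hΛ.ne'] at h1
  rw [norm_smul, Real.norm_of_nonneg (Real.exp_pos _).le, Real.exp_neg]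
  have h2 := Real.exp_pos (Λ * (t - s))
  calc (Real.exp (Λ * (t - s)))⁻¹ * ‖∫ r in s..t, f r‖
      ≤ (Real.exp (Λ * (t - s)))⁻¹ * (C * (Real.exp (Λ * (t - s)) / Λ)) := by
        gcongr
        refine h1.trans ?_
        gcongr
        linarith
    _ = C / Λ := by field_simp

/-- Global existence for `ζ' = g ζ + v`, in the sense of Carathéodory. -/
theorem exists_integral_solution [CompleteSpace Z] {g : Z → Z} {L : ℝ≥0}
    (hg : LipschitzWith L g) {v : ℝ → Z} {s K : ℝ}
    (hvm : AEStronglyMeasurable v (volume.restrict (Set.Ici s)))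
    (hvK : ∀ᵐ r ∂volume.restrict (Set.Ici s), ‖v r‖ ≤ K) (z₀ : Z) :
    ∃ ζ : ℝ → Z, ContinuousOn ζ (Set.Ici s) ∧ ζ s = z₀ ∧
      ∀ t, s ≤ t → ζ t = z₀ + ∫ r in s..t, (g (ζ r) + v r) := by
  -- Bielecki's weight: the unknown is $\eta(t)=e^{-\Lambda(t-s)}\zeta(t)$. In the sup norm on
  -- $\eta$, the Picard map has contraction constant $L/\Lambda<1$ on the whole half-line, so no
  -- continuation argument is needed.
  set Λ : ℝ := L + 1 with hΛ
  have hΛ1 : 1 ≤ Λ := by simp [hΛ]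
  have hΛ0 : 0 < Λ := by linarith
  have hvK' : ∀ᵐ r, r ∈ Set.Ici s → ‖v r‖ ≤ K := (ae_restrict_iff' measurableSet_Ici).1 hvK
  have hvi : ∀ t, s ≤ t → IntervalIntegrable v volume s t := by
    intro t ht
    rw [intervalIntegrable_iff_integrableOn_Icc_of_le ht]
    refine Integrable.mono' (g := fun _ => K) (integrable_const _)
      (hvm.mono_measure (Measure.restrict_mono Set.Icc_subset_Ici_self le_rfl)) ?_
    exact ae_restrict_of_ae_restrict_of_subset Set.Icc_subset_Ici_self hvK
  let F : BoundedContinuousFunction ℝ Z → ℝ → Z :=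
    fun η r => g (Real.exp (Λ * (r - s)) • η r) + v r
  have hFi : ∀ η t, s ≤ t → IntervalIntegrable (F η) volume s t := by
    intro η t ht
    refine IntervalIntegrable.add (Continuous.intervalIntegrable ?_ _ _) (hvi t ht)
    exact hg.continuous.comp (Continuous.smul (by fun_prop) η.continuous)
  -- The `max t s` extends the Picard map by a constant to the left of `s`, so that the fixed point
  -- can be sought among bounded continuous functions on all of `ℝ`.
  let Ψ : BoundedContinuousFunction ℝ Z → ℝ → Z := fun η t =>
    Real.exp (-(Λ * (max t s - s))) • (z₀ + ∫ r in s..max t s, F η r)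
  have hΨc : ∀ η, Continuous (Ψ η) := by
    intro η
    refine Continuous.smul (by fun_prop) (continuous_const.add ?_)
    -- Nothing is known about `v` before `s`; the indicator makes the integrand integrable on every
    -- interval without changing the primitive on `[s, ∞)`.
    have hii : ∀ a b : ℝ, IntervalIntegrable ((Set.Ici s).indicator (F η)) volume a b := by
      intro a b
      have hloc : ∀ c, IntervalIntegrable ((Set.Ici s).indicator (F η)) volume s c := by
        intro c
        rcases le_total s c with h | h
        · refine (hFi η c h).congr_ae ?_
          rw [Filter.EventuallyEq, ae_restrict_iff' measurableSet_uIoc]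
          refine Eventually.of_forall fun r hr => ?_
          rw [Set.uIoc_of_le h] at hr
          rw [Set.indicator_of_mem (Set.mem_Ici.2 hr.1.le)]
        · refine IntervalIntegrable.congr_ae (f := fun _ => (0 : Z)) (by simp) ?_
          rw [Filter.EventuallyEq, ae_restrict_iff' measurableSet_uIoc]
          have : ∀ᵐ r : ℝ, r ≠ s := by simp [ae_iff, measure_singleton]
          filter_upwards [this] with r hne hr
          rw [Set.uIoc_of_ge h] at hr
          rw [Set.indicator_of_notMem]
          simp only [Set.mem_Ici, not_le]
          exact lt_of_le_of_ne hr.2 hne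
      exact (hloc a).symm.trans (hloc b)
    have h1 := (intervalIntegral.continuous_primitive hii s).comp
      (continuous_id.max (continuous_const (y := s)))
    refine h1.congr fun t => ?_
    refine intervalIntegral.integral_congr fun r hr => ?_
    rw [Set.uIcc_of_le (le_max_right _ _)] at hr
    exact Set.indicator_of_mem (Set.mem_Ici.2 hr.1) _
  have hΨb : ∀ η t, ‖Ψ η t‖ ≤ ‖z₀‖ + (‖g 0‖ + |K| + L * ‖η‖) / Λ := by
    intro η t
    have hst : s ≤ max t s := le_max_right _ _
    have h1 : ‖Real.exp (-(Λ * (max t s - s))) • z₀‖ ≤ ‖z₀‖ := by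
      rw [norm_smul, Real.norm_of_nonneg (Real.exp_pos _).le]
      refine mul_le_of_le_one_left (norm_nonneg _) (Real.exp_le_one_iff.2 ?_)
      have := mul_nonneg hΛ0.le (sub_nonneg.2 hst)
      linarith
    have h2 : ‖Real.exp (-(Λ * (max t s - s))) • ∫ r in s..max t s, F η r‖
        ≤ (‖g 0‖ + |K| + L * ‖η‖) / Λ := by
      refine norm_exp_smul_integral_le hst (by positivity) hΛ0 ?_
      filter_upwards [hvK'] with r hr hrm
      have hv := (hr (Set.mem_Ici.2 hrm.1.le)).trans (le_abs_self K)
      set E := Real.exp (Λ * (r - s)) with hE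
      have hE1 : 1 ≤ E := Real.one_le_exp (mul_nonneg hΛ0.le (sub_nonneg.2 hrm.1.le))
      have hgE : ‖g (E • η r)‖ ≤ ‖g 0‖ + L * (E * ‖η‖) := by
        have h3 := hg.dist_le_mul (E • η r) 0
        rw [dist_eq_norm, dist_zero_right, norm_smul,
          Real.norm_of_nonneg (by linarith : (0:ℝ) ≤ E)] at h3
        have h4 : (L : ℝ) * (E * ‖η r‖) ≤ L * (E * ‖η‖) := by
          gcongr
          exact η.norm_coe_le_norm r
        have h5 := norm_sub_norm_le (g (E • η r)) (g 0)
        linarith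
      calc ‖F η r‖ ≤ ‖g (E • η r)‖ + ‖v r‖ := norm_add_le _ _
        _ ≤ (‖g 0‖ + L * (E * ‖η‖)) + |K| := by gcongr
        _ ≤ (‖g 0‖ + |K|) * E + L * (E * ‖η‖) := by
          have := mul_le_mul_of_nonneg_left hE1 (by positivity : 0 ≤ ‖g 0‖ + |K|)
          linarith
        _ = _ := by ring
    calc ‖Ψ η t‖ ≤ _ := by
          simp only [Ψ, smul_add]
          exact norm_add_le _ _
      _ ≤ _ := add_le_add h1 h2
  let Φ : BoundedContinuousFunction ℝ Z → BoundedContinuousFunction ℝ Z := fun η =>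
    BoundedContinuousFunction.ofNormedAddCommGroup (Ψ η) (hΨc η) _ (hΨb η)
  have hlip : ContractingWith (L / (L + 1)) Φ := by
    refine ⟨?_, LipschitzWith.of_dist_le_mul fun η θ => ?_⟩
    · rw [div_lt_one (by positivity)]
      exact lt_add_one L
    · refine (BoundedContinuousFunction.dist_le (by positivity)).2 fun t => ?_
      have hst : s ≤ max t s := le_max_right _ _
      have heq : Φ η t - Φ θ t = Real.exp (-(Λ * (max t s - s))) •
          ∫ r in s..max t s, (F η r - F θ r) := by
        rw [intervalIntegral.integral_sub (hFi η _ hst) (hFi θ _ hst)]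
        change Ψ η t - Ψ θ t = _
        simp only [Ψ]
        rw [← smul_sub]
        congr 1
        abel
      rw [dist_eq_norm, heq]
      have := norm_exp_smul_integral_le (f := fun r => F η r - F θ r) (C := L * dist η θ) hst
        (by positivity) hΛ0 (Eventually.of_forall fun r hr => ?_)
      · refine this.trans (le_of_eq ?_)
        push_cast
        rw [hΛ]
        ring
      · simp only [F, add_sub_add_right_eq_sub]
        rw [← dist_eq_norm]
        refine (hg.dist_le_mul _ _).trans ?_
        rw [dist_smul₀, Real.norm_of_nonneg (Real.exp_pos _).le]
        have := η.dist_coe_le_dist (g := θ) r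
        calc (L : ℝ) * (Real.exp (Λ * (r - s)) * dist (η r) (θ r))
            ≤ L * (Real.exp (Λ * (r - s)) * dist η θ) := by gcongr
          _ = _ := by ring
  set η := ContractingWith.fixedPoint Φ hlip with hη
  have hfix : ∀ t, Ψ η t = η t := fun t => by
    have h := hlip.fixedPoint_isFixedPt
    have h' := congrArg (fun f : BoundedContinuousFunction ℝ Z => f t) h.eq
    exact h'
  have hsol : ∀ t, s ≤ t → Real.exp (Λ * (t - s)) • η t = z₀ + ∫ r in s..t, F η r := by
    intro t ht
    rw [← hfix t]
    simp only [Ψ, max_eq_left ht]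
    rw [smul_smul, ← Real.exp_add]
    simp
  refine ⟨fun t => Real.exp (Λ * (t - s)) • η t, ?_, ?_, ?_⟩
  · exact (Continuous.smul (by fun_prop) η.continuous).continuousOn
  · exact (hsol s le_rfl).trans (by simp)
  · exact hsol

/-- Along an absolutely continuous curve, a quadratic form `V` with `V' ≤ -c (V - D)` almost
everywhere satisfies the corresponding exponential estimate. -/
theorem quadratic_sub_le_exp_mul [CompleteSpace Z] (B : Z →L[ℝ] Z →L[ℝ] ℝ)
    {ζ f : ℝ → Z} {a b c D K : ℝ}
    (hab : a ≤ b) (hfi : IntervalIntegrable f volume a b)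
    (hfK : ∀ᵐ r, r ∈ Set.Icc a b → ‖f r‖ ≤ K)
    (hζ : ∀ t ∈ Set.Icc a b, ζ t = ζ a + ∫ r in a..t, f r)
    (hV : ∀ᵐ r, r ∈ Set.Icc a b →
      B (ζ r) (f r) + B (f r) (ζ r) ≤ -c * (B (ζ r) (ζ r) - D)) :
    B (ζ b) (ζ b) - D ≤ Real.exp (-c * (b - a)) * (B (ζ a) (ζ a) - D) := by
  have hu : Set.uIcc a b = Set.Icc a b := Set.uIcc_of_le hab
  have hK : ∀ᵐ r, r ∈ Set.Icc a b → ‖f r‖ ≤ |K| := by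
    filter_upwards [hfK] with r hr hm using (hr hm).trans (le_abs_self K)
  have hfa : ∀ x ∈ Set.Icc a b, IntervalIntegrable f volume a x := fun x hx =>
    hfi.mono_set (Set.uIcc_subset_uIcc Set.left_mem_uIcc (hu ▸ hx))
  have hsub : ∀ x ∈ Set.Icc a b, ∀ y ∈ Set.Icc a b, ζ x - ζ y = ∫ r in y..x, f r := by
    intro x hx y hy
    rw [hζ x hx, hζ y hy, add_sub_add_left_eq_sub,
      intervalIntegral.integral_interval_sub_left (hfa x hx) (hfa y hy)]
  have hlip : ∀ x ∈ Set.Icc a b, ∀ y ∈ Set.Icc a b, ‖ζ x - ζ y‖ ≤ |K| * |x - y| := by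
    intro x hx y hy
    rw [hsub x hx y hy]
    refine intervalIntegral.norm_integral_le_of_norm_le_const_ae ?_
    filter_upwards [hK] with r hr hm
    refine hr ?_
    rw [← hu] at hx hy ⊢
    exact Set.uIcc_subset_uIcc hy hx (Set.uIoc_subset_uIcc hm)
  set R := ‖ζ a‖ + |K| * (b - a) with hR
  have hbd : ∀ x ∈ Set.Icc a b, ‖ζ x‖ ≤ R := by
    intro x hx
    have h1 := hlip x hx a ⟨le_rfl, hab⟩
    have h2 := norm_sub_norm_le (ζ x) (ζ a)
    rw [abs_of_nonneg (sub_nonneg.2 hx.1)] at h1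
    have h3 : |K| * (x - a) ≤ |K| * (b - a) := by gcongr; exact hx.2
    linarith
  have hR0 : 0 ≤ R := (norm_nonneg _).trans (hbd a ⟨le_rfl, hab⟩)
  -- The curve is Lipschitz since `f` is essentially bounded, and it stays in the ball of radius
  -- `R`, on which the quadratic form is Lipschitz.
  have hVlip : LipschitzOnWith (Real.toNNReal (2 * ‖B‖ * R * |K|))
      (fun t => B (ζ t) (ζ t) - D) (Set.uIcc a b) := by
    rw [hu]
    refine LipschitzOnWith.of_dist_le_mul fun x hx y hy => ?_
    rw [Real.coe_toNNReal _ (by positivity), Real.dist_eq, Real.dist_eq]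
    have h1 : B (ζ x) (ζ x) - D - (B (ζ y) (ζ y) - D)
        = B (ζ x - ζ y) (ζ x) + B (ζ y) (ζ x - ζ y) := by
      simp only [map_sub, sub_apply]
      ring
    rw [h1]
    have h2 := B.le_opNorm₂ (ζ x - ζ y) (ζ x)
    have h3 := B.le_opNorm₂ (ζ y) (ζ x - ζ y)
    have h4 := hlip x hx y hy
    calc |B (ζ x - ζ y) (ζ x) + B (ζ y) (ζ x - ζ y)|
        ≤ ‖B‖ * ‖ζ x - ζ y‖ * ‖ζ x‖ + ‖B‖ * ‖ζ y‖ * ‖ζ x - ζ y‖ :=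
          (abs_add_le _ _).trans (add_le_add h2 h3)
      _ ≤ ‖B‖ * (|K| * |x - y|) * R + ‖B‖ * R * (|K| * |x - y|) := by
          gcongr
          · exact hbd x hx
          · exact hbd y hy
      _ = 2 * ‖B‖ * R * |K| * |x - y| := by ring
  have hexp : AbsolutelyContinuousOnInterval (fun t : ℝ => Real.exp (c * (t - a))) a b :=
    ContDiffOn.absolutelyContinuousOnInterval (ContDiff.contDiffOn (by fun_prop))
  have hac := hexp.fun_mul hVlip.absolutelyContinuousOnInterval
  -- The weighted function $e^{c(t-a)}(V-D)$ is absolutely continuous with nonpositive derivative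
  -- almost everywhere, hence it does not increase from `a` to `b`. The endpoints are discarded
  -- because the integral equation is known only inside `[a, b]`.
  have hder : ∀ᵐ r, r ∈ Set.Icc a b →
      deriv (fun t => Real.exp (c * (t - a)) * (B (ζ t) (ζ t) - D)) r ≤ 0 := by
    have ha : ∀ᵐ r : ℝ, r ≠ a := by simp [ae_iff, measure_singleton]
    have hb : ∀ᵐ r : ℝ, r ≠ b := by simp [ae_iff, measure_singleton]
    filter_upwards [hfi.ae_hasDerivAt_integral, hV, ha, hb] with r hr hVr hra hrb hm
    have h1 := (hr (hu ▸ hm) a (hu ▸ ⟨le_rfl, hab⟩)).const_add (ζ a)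
    have h2 : HasDerivAt ζ (f r) r := by
      refine h1.congr_of_eventuallyEq ?_
      filter_upwards [Icc_mem_nhds (lt_of_le_of_ne hm.1 hra.symm) (lt_of_le_of_ne hm.2 hrb)]
        with t ht using hζ t ht
    have h3 : HasDerivAt (fun t => B (ζ t) (ζ t)) (B (ζ r) (f r) + B (f r) (ζ r)) r :=
      B.hasDerivAt_of_bilinear (fun _ => h2) (fun _ => h2)
    have h4 : HasDerivAt (fun t : ℝ => c * (t - a)) (c * 1) r :=
      ((hasDerivAt_id r).sub_const a).const_mul c
    rw [(h4.exp.fun_mul (h3.sub_const D)).deriv]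
    have h5 := mul_le_mul_of_nonneg_left (hVr hm) (Real.exp_pos (c * (r - a))).le
    nlinarith
  have hint := hac.integral_deriv_eq_sub
  have hle : ∫ t in a..b, deriv (fun t => Real.exp (c * (t - a)) * (B (ζ t) (ζ t) - D)) t ≤ 0 := by
    have h1 := intervalIntegral.integral_mono_ae_restrict hab hac.intervalIntegrable_deriv
      (intervalIntegrable_const (c := (0 : ℝ)))
      ((ae_restrict_iff' measurableSet_Icc).2 hder)
    simpa using h1
  rw [hint] at hle
  simp only [sub_self, mul_zero, Real.exp_zero, one_mul] at hle
  have h6 : Real.exp (-c * (b - a)) * Real.exp (c * (b - a)) = 1 := by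
    rw [← Real.exp_add]
    simp
  have h7 := mul_le_mul_of_nonneg_left (sub_nonpos.1 hle) (Real.exp_pos (-c * (b - a))).le
  rwa [← mul_assoc, h6, one_mul] at h7

end IntegralEquation

/-! ### The vector fields of the closed loop -/

/-- Multiplication by a matrix as a continuous linear map of Euclidean spaces. -/
noncomputable def matVecL {m n : Type*} [Fintype m] [Fintype n] (A : Matrix m n ℝ) :
    EuclideanSpace ℝ n →L[ℝ] EuclideanSpace ℝ m :=
  LinearMap.toContinuousLinearMap
    { toFun := matVec A
      map_add' := fun x y => by simp [matVec, Matrix.mulVec_add]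
      map_smul' := fun c x => by simp [matVec, Matrix.mulVec_smul] }

theorem matVecL_apply {m n : Type*} [Fintype m] [Fintype n] (A : Matrix m n ℝ)
    (v : EuclideanSpace ℝ n) : matVecL A v = A ⬝ₑ v := rfl

/-- `pair` as a continuous linear map. -/
noncomputable def pairL (n : ℕ) : (Vec n × Vec n) →L[ℝ] PairVec n :=
  LinearMap.toContinuousLinearMap
    { toFun := fun v => pair v.1 v.2
      map_add' := fun x y => by ext (i | i) <;> simp [pair]
      map_smul' := fun c x => by ext (i | i) <;> simp [pair] }

theorem pairL_apply {n : ℕ} (x e : Vec n) : pairL n (x, e) = pair x e := rfl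

/-- `plantState` as a continuous linear map. -/
noncomputable def plantStateL (n : ℕ) : PairVec n →L[ℝ] Vec n :=
  LinearMap.toContinuousLinearMap
    { toFun := plantState
      map_add' := fun x y => by ext i; simp [plantState]
      map_smul' := fun c x => by ext i; simp [plantState] }

/-- `observerState` as a continuous linear map. -/
noncomputable def observerStateL (n : ℕ) : PairVec n →L[ℝ] Vec n :=
  LinearMap.toContinuousLinearMap
    { toFun := observerState
      map_add' := fun x y => by ext i; simp [plantState, estError, observerState]; ring
      map_smul' := fun c x => by ext i; simp [plantState, estError, observerState]; ring }

/-- `V(z) = zᵀ P z` comes from a continuous bilinear form. -/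
noncomputable def quadFormL {n : ℕ} (P : Matrix (Fin n ⊕ Fin n) (Fin n ⊕ Fin n) ℝ) :
    PairVec n →L[ℝ] PairVec n →L[ℝ] ℝ :=
  (innerSL ℝ).flip.comp (matVecL P) |>.flip

theorem quadFormL_apply_self {n : ℕ} (P : Matrix (Fin n ⊕ Fin n) (Fin n ⊕ Fin n) ℝ)
    (z : PairVec n) : quadFormL P z z = quadForm P z := by
  simp only [quadFormL, ContinuousLinearMap.flip_apply, ContinuousLinearMap.comp_apply,
    innerSL_apply_apply, matVecL_apply]
  simp [quadForm, matVec, EuclideanSpace.inner_eq_star_dotProduct, dotProduct_comm (P *ᵥ z.ofLp)]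

theorem contDiff_quadForm {n : ℕ} (P : Matrix (Fin n ⊕ Fin n) (Fin n ⊕ Fin n) ℝ) :
    ContDiff ℝ ∞ (quadForm P) := by
  have h : quadForm P = fun z => quadFormL P z z := funext fun z => (quadFormL_apply_self P z).symm
  rw [h]
  exact (quadFormL P).contDiff.clm_apply contDiff_id

theorem derivAlong_quadForm {n : ℕ} (P : Matrix (Fin n ⊕ Fin n) (Fin n ⊕ Fin n) ℝ)
    (z v : PairVec n) :
    derivAlong (quadForm P) z v = quadFormL P z v + quadFormL P v z := by
  have h : quadForm P = fun z => quadFormL P z z := funext fun z => (quadFormL_apply_self P z).symm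
  have h1 : HasFDerivAt (fun z => quadFormL P z z) _ z :=
    (quadFormL P).hasFDerivAt.clm_apply (hasFDerivAt_id z)
  rw [derivAlong, h, h1.fderiv]
  simp

/-- Compactness gives a positive minimum on the unit sphere, and homogeneity of degree two carries
it to every vector. -/
theorem exists_mul_sq_le_quadForm {n : ℕ} {P : Matrix (Fin n ⊕ Fin n) (Fin n ⊕ Fin n) ℝ}
    (hP : P.PosDef) : ∃ l : ℝ, 0 < l ∧ ∀ z, l * ‖z‖ ^ 2 ≤ quadForm P z := by
  have hpos : ∀ z : PairVec n, z ≠ 0 → 0 < quadForm P z := by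
    intro z hz
    have := hP.dotProduct_mulVec_pos (x := z.ofLp) (by simpa using hz)
    simpa [quadForm] using this
  have hc : Continuous (quadForm P) := (contDiff_quadForm P).continuous
  -- The sphere is empty in dimension zero, where any positive constant works.
  rcases (Metric.sphere (0 : PairVec n) 1).eq_empty_or_nonempty with he | hne
  · refine ⟨1, one_pos, fun z => ?_⟩
    have hz : z = 0 := by
      by_contra hz
      have : (‖z‖⁻¹ • z) ∈ Metric.sphere (0 : PairVec n) 1 := by
        simp [norm_smul, hz]
      rw [he] at this
      exact this
    simp [hz, quadForm]
  · obtain ⟨z₁, hz₁, hmin⟩ := (isCompact_sphere (0 : PairVec n) 1).exists_isMinOn hne hc.continuousOn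
    have hz₁0 : z₁ ≠ 0 := by
      rintro rfl
      simp at hz₁
    refine ⟨quadForm P z₁, hpos _ hz₁0, fun z => ?_⟩
    rcases eq_or_ne z 0 with rfl | hz
    · simp [quadForm]
    · have hm : (‖z‖⁻¹ • z) ∈ Metric.sphere (0 : PairVec n) 1 := by simp [norm_smul, hz]
      have h1 : quadForm P z₁ ≤ quadForm P (‖z‖⁻¹ • z) := hmin hm
      rw [← quadFormL_apply_self P (‖z‖⁻¹ • z)] at h1
      simp only [map_smul, smul_apply, smul_eq_mul, quadFormL_apply_self] at h1
      have hzn : 0 < ‖z‖ := norm_pos_iff.2 hz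
      calc quadForm P z₁ * ‖z‖ ^ 2 ≤ (‖z‖⁻¹ * (‖z‖⁻¹ * quadForm P z)) * ‖z‖ ^ 2 := by gcongr
        _ = quadForm P z := by field_simp

section Fields

variable {nx nu ny nq np nw : ℕ}

/-- The effect of the control `u = k(x)` on `(ẋ, ė)`. -/
noncomputable def Plant.actuation (S : Plant nx nu ny nq np nw) (G : Gains nx nu ny nq np)
    (x : Vec nx) : PairVec nx :=
  pair (S.B ⬝ₑ S.feedback G x) 0

/-- The effect of the disturbance on `(ẋ, ė)`. -/
noncomputable def Plant.disturbanceL (S : Plant nx nu ny nq np nw) : Vec nw →L[ℝ] PairVec nx :=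
  (pairL nx).comp ((matVecL S.Ew).prod (matVecL S.Ew))

/-- In $\hat y-y$ the terms $Du$ cancel, and without measurement noise only $C(\hat x-x)$ is left.
So `w` never reaches the argument of `p` and enters additively, while `u` drops out of the equation
for `e`. -/
theorem Plant.pairField_eq (S : Plant nx nu ny nq np nw) (G : Gains nx nu ny nq np)
    (hFw : S.Fw = 0) (u : Vec nu) (z : PairVec nx) (w : Vec nw) :
    S.pairField G u z w =
      pairL nx
        (matVecL S.A (plantState z) + matVecL S.E (S.p (matVecL S.Cq (plantState z))),
          matVecL S.A (plantState z) + matVecL S.E (S.p (matVecL S.Cq (plantState z)))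
            - (matVecL S.A (observerState z)
              + matVecL S.E (S.p (matVecL S.Cq (observerState z)
                + matVecL G.L₁ (matVecL S.C (observerState z) - matVecL S.C (plantState z))))
              + matVecL G.L₂ (matVecL S.C (observerState z) - matVecL S.C (plantState z))))
        + pairL nx (matVecL S.B u, 0) + S.disturbanceL w := by
  have hy : S.C ⬝ₑ observerState z + S.D ⬝ₑ u - S.output (plantState z) u w
      = matVecL S.C (observerState z) - matVecL S.C (plantState z) := by
    have h0 : S.Fw ⬝ₑ w = 0 := by simp [hFw, matVec]
    rw [Plant.output, h0, matVecL_apply, matVecL_apply]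
    abel
  have hd : S.disturbanceL w = pairL nx (matVecL S.Ew w, matVecL S.Ew w) := rfl
  rw [hd, ← map_add, ← map_add, Plant.pairField, Plant.observerField, hy, Plant.stateField,
    ← pairL_apply]
  simp only [← matVecL_apply]
  congr 1
  ext1 <;> simp only [Prod.fst_add, Prod.snd_add] <;> abel

/-- This exhibits the sampled loop as the undisturbed continuous loop plus a sampling error and an
additive disturbance. -/
theorem Plant.sampledField_eq (S : Plant nx nu ny nq np nw) (G : Gains nx nu ny nq np)
    (hFw : S.Fw = 0) (xs : Vec nx) (z : PairVec nx) (w : Vec nw) :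
    S.sampledField G xs z w = S.continuousField G z 0
      + (S.actuation G xs - S.actuation G (observerState z)) + S.disturbanceL w := by
  have ha : ∀ x, S.actuation G x = pairL nx (matVecL S.B (S.feedback G x), 0) := fun x => rfl
  rw [Plant.sampledField, Plant.continuousField, S.pairField_eq G hFw, S.pairField_eq G hFw,
    ha, ha, map_zero]
  abel

/-- The values of the Lipschitz constants never matter, so existential forms let the bounds be
composed along the structure of the field. -/
theorem LipschitzWith.exists_add {X E : Type*} [PseudoMetricSpace X] [SeminormedAddCommGroup E]
    {f g : X → E} (hf : ∃ K, LipschitzWith K f) (hg : ∃ K, LipschitzWith K g) :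
    ∃ K, LipschitzWith K fun x => f x + g x :=
  let ⟨_, h⟩ := hf
  let ⟨_, h'⟩ := hg
  ⟨_, h.add h'⟩

theorem LipschitzWith.exists_sub {X E : Type*} [PseudoMetricSpace X] [SeminormedAddCommGroup E]
    {f g : X → E} (hf : ∃ K, LipschitzWith K f) (hg : ∃ K, LipschitzWith K g) :
    ∃ K, LipschitzWith K fun x => f x - g x :=
  let ⟨_, h⟩ := hf
  let ⟨_, h'⟩ := hg
  ⟨_, h.sub h'⟩

theorem LipschitzWith.exists_comp {X Y W : Type*} [PseudoMetricSpace X] [PseudoMetricSpace Y]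
    [PseudoMetricSpace W] {g : Y → W} {f : X → Y}
    (hg : ∃ K, LipschitzWith K g) (hf : ∃ K, LipschitzWith K f) :
    ∃ K, LipschitzWith K fun x => g (f x) :=
  let ⟨_, h⟩ := hf
  let ⟨_, h'⟩ := hg
  ⟨_, h'.comp h⟩

theorem LipschitzWith.exists_prodMk {X Y W : Type*} [PseudoMetricSpace X] [PseudoMetricSpace Y]
    [PseudoMetricSpace W] {g : X → W} {f : X → Y}
    (hf : ∃ K, LipschitzWith K f) (hg : ∃ K, LipschitzWith K g) :
    ∃ K, LipschitzWith K fun x => (f x, g x) :=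
  let ⟨_, h⟩ := hf
  let ⟨_, h'⟩ := hg
  ⟨_, h.prodMk h'⟩

theorem ContinuousLinearMap.exists_lipschitzWith {E F : Type*} [NormedAddCommGroup E]
    [NormedSpace ℝ E] [NormedAddCommGroup F] [NormedSpace ℝ F] (T : E →L[ℝ] F) :
    ∃ K, LipschitzWith K T :=
  ⟨_, T.lipschitz⟩

open LipschitzWith in
theorem Plant.exists_lipschitzWith_actuation (S : Plant nx nu ny nq np nw)
    (G : Gains nx nu ny nq np) (hp : ∃ ℓ : ℝ≥0, LipschitzWith ℓ S.p) :
    ∃ K, LipschitzWith K (S.actuation G) := by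
  have hL := fun {m n : ℕ} (A : Matrix (Fin m) (Fin n) ℝ) => (matVecL A).exists_lipschitzWith
  have hk : ∃ K, LipschitzWith K fun x => matVecL G.K₁ x + matVecL G.K₂ (S.p (matVecL S.Cq x)) :=
    exists_add (hL G.K₁) (exists_comp (hL G.K₂) (exists_comp hp (hL S.Cq)))
  have hu : ∃ K, LipschitzWith K fun x : Vec nx =>
      (matVecL S.B (matVecL G.K₁ x + matVecL G.K₂ (S.p (matVecL S.Cq x))), (0 : Vec nx)) :=
    exists_prodMk (exists_comp (hL S.B) hk) ⟨0, LipschitzWith.const 0⟩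
  obtain ⟨K, hK⟩ := hu
  have heq : S.actuation G = pairL nx ∘ fun x =>
      (matVecL S.B (matVecL G.K₁ x + matVecL G.K₂ (S.p (matVecL S.Cq x))), (0 : Vec nx)) :=
    funext fun x => rfl
  rw [heq]
  exact ⟨_, (pairL nx).lipschitz.comp hK⟩

open LipschitzWith in
theorem Plant.exists_lipschitzWith_continuousField (S : Plant nx nu ny nq np nw)
    (G : Gains nx nu ny nq np) (hFw : S.Fw = 0) (hp : ∃ ℓ : ℝ≥0, LipschitzWith ℓ S.p) :
    ∃ K, LipschitzWith K (fun z => S.continuousField G z 0) := by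
  have hL := fun {m n : ℕ} (A : Matrix (Fin m) (Fin n) ℝ) => (matVecL A).exists_lipschitzWith
  have hx : ∃ K, LipschitzWith K (plantState (n := nx)) := (plantStateL nx).exists_lipschitzWith
  have ho : ∃ K, LipschitzWith K (observerState (n := nx)) :=
    (observerStateL nx).exists_lipschitzWith
  have hs := exists_add (exists_comp (hL S.A) hx)
    (exists_comp (hL S.E) (exists_comp hp (exists_comp (hL S.Cq) hx)))
  have hy := exists_sub (exists_comp (hL S.C) ho) (exists_comp (hL S.C) hx)
  have ha : ∃ K, LipschitzWith K fun z : PairVec nx =>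
      pairL nx (matVecL S.B (S.feedback G (observerState z)), 0) :=
    exists_comp (g := S.actuation G) (S.exists_lipschitzWith_actuation G hp) ho
  simp only [Plant.continuousField, S.pairField_eq G hFw]
  exact exists_add (exists_add (exists_comp (pairL nx).exists_lipschitzWith
    (exists_prodMk hs (exists_sub hs (exists_add (exists_add (exists_comp (hL S.A) ho)
      (exists_comp (hL S.E) (exists_comp hp (exists_add (exists_comp (hL S.Cq) ho)
        (exists_comp (hL G.L₁) hy))))) (exists_comp (hL G.L₂) hy))))) ha)
    ⟨0, LipschitzWith.const _⟩

theorem Plant.continuousField_zero (S : Plant nx nu ny nq np nw)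
    (G : Gains nx nu ny nq np) (hFw : S.Fw = 0) (hp0 : S.p 0 = 0) :
    S.continuousField G 0 0 = 0 := by
  have hx : plantState (0 : PairVec nx) = 0 := map_zero (plantStateL nx)
  have ho : observerState (0 : PairVec nx) = 0 := map_zero (observerStateL nx)
  rw [Plant.continuousField, S.pairField_eq G hFw, Plant.feedback, hx, ho]
  simp only [← matVecL_apply]
  have h0 : pairL nx (0, 0) = 0 := map_zero (pairL nx)
  simp [hp0, h0]

end Fields

/-! ### Solutions with a held sample -/

section HeldSolutions

variable {nx nu ny nq np nw : ℕ} {S : Plant nx nu ny nq np nw} {G : Gains nx nu ny nq np}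

theorem ae_norm_le_signalNorm {n : ℕ} {w : ℝ → Vec n}
    (hw : MemLp w ∞ (volume.restrict (Set.Ici (0 : ℝ)))) :
    ∀ᵐ r, r ∈ Set.Ici (0 : ℝ) → ‖w r‖ ≤ signalNorm w := by
  rw [← ae_restrict_iff' measurableSet_Ici]
  filter_upwards [ae_le_eLpNormEssSup (f := w) (μ := volume.restrict (Set.Ici (0 : ℝ)))] with r hr
  rw [← eLpNorm_exponent_top] at hr
  have h := ENNReal.toNNReal_mono hw.eLpNorm_ne_top hr
  rw [enorm_eq_nnnorm, ENNReal.toNNReal_coe] at h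
  exact_mod_cast h

theorem norm_observerState_le {n : ℕ} (z : PairVec n) :
    ‖observerState z‖ ≤ ‖observerStateL n‖ * ‖z‖ :=
  (observerStateL n).le_opNorm z

theorem norm_observerState_sub_le {n : ℕ} (z z' : PairVec n) :
    ‖observerState z - observerState z'‖ ≤ ‖observerStateL n‖ * ‖z - z'‖ := by
  have h := (observerStateL n).le_opNorm (z - z')
  rwa [map_sub] at h

theorem Plant.norm_actuation_add_disturbanceL_le {Lb : ℝ≥0}
    (hb : LipschitzWith Lb (S.actuation G)) (xs x : Vec nx) (w : Vec nw) :
    ‖(S.actuation G xs - S.actuation G x) + S.disturbanceL w‖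
      ≤ Lb * ‖xs - x‖ + ‖S.disturbanceL‖ * ‖w‖ := by
  refine (norm_add_le _ _).trans (add_le_add ?_ (S.disturbanceL.le_opNorm w))
  have h := hb.dist_le_mul xs x
  rwa [dist_eq_norm, dist_eq_norm] at h

theorem Plant.norm_sampledField_le (hFw : S.Fw = 0) (hp0 : S.p 0 = 0) {Lf Lb : ℝ≥0}
    (hf : LipschitzWith Lf (fun z => S.continuousField G z 0))
    (hb : LipschitzWith Lb (S.actuation G)) (xs : Vec nx) (z : PairVec nx) (w : Vec nw) :
    ‖S.sampledField G xs z w‖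
      ≤ Lf * ‖z‖ + (Lb * ‖xs - observerState z‖ + ‖S.disturbanceL‖ * ‖w‖) := by
  rw [S.sampledField_eq G hFw, add_assoc]
  refine (norm_add_le _ _).trans (add_le_add ?_ (S.norm_actuation_add_disturbanceL_le hb _ _ _))
  have h := hf.dist_le_mul z 0
  simpa [S.continuousField_zero G hFw hp0] using h

/-- The disturbance enters the sampled closed loop additively. -/
theorem Plant.sampledField_eq_add_disturbanceL (hFw : S.Fw = 0) (xs : Vec nx) (z : PairVec nx)
    (w : Vec nw) :
    S.sampledField G xs z w = S.sampledField G xs z 0 + S.disturbanceL w := by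
  rw [S.sampledField_eq G hFw, S.sampledField_eq G hFw xs z 0, map_zero, add_zero]

theorem Plant.exists_lipschitzWith_sampledField (hFw : S.Fw = 0)
    (hp : ∃ ℓ : ℝ≥0, LipschitzWith ℓ S.p) (xs : Vec nx) :
    ∃ K, LipschitzWith K (fun z => S.sampledField G xs z 0) := by
  simp only [S.sampledField_eq G hFw, map_zero, add_zero]
  exact LipschitzWith.exists_add (S.exists_lipschitzWith_continuousField G hFw hp)
    (LipschitzWith.exists_sub ⟨0, LipschitzWith.const _⟩
      (LipschitzWith.exists_comp (g := S.actuation G) (S.exists_lipschitzWith_actuation G hp)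
        (observerStateL nx).exists_lipschitzWith))

theorem Plant.exists_isHeldSolution (hFw : S.Fw = 0) (hp : ∃ ℓ : ℝ≥0, LipschitzWith ℓ S.p)
    {w : ℝ → Vec nw} (hw : MemLp w ∞ (volume.restrict (Set.Ici (0 : ℝ)))) {s : ℝ} (hs : 0 ≤ s)
    (z₀ : PairVec nx) : ∃ ζ, S.IsHeldSolution G w s ζ ∧ ζ s = z₀ := by
  obtain ⟨L, hL⟩ := Plant.exists_lipschitzWith_sampledField (G := G) hFw hp (observerState z₀)
  have hsub : Set.Ici s ⊆ Set.Ici (0 : ℝ) := Set.Ici_subset_Ici.2 hs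
  have hm : AEStronglyMeasurable (fun r => S.disturbanceL (w r)) (volume.restrict (Set.Ici s)) :=
    (S.disturbanceL.continuous.comp_aestronglyMeasurable hw.1).mono_measure
      (Measure.restrict_mono hsub le_rfl)
  have hK : ∀ᵐ r ∂volume.restrict (Set.Ici s),
      ‖S.disturbanceL (w r)‖ ≤ ‖S.disturbanceL‖ * signalNorm w := by
    rw [ae_restrict_iff' measurableSet_Ici]
    filter_upwards [ae_norm_le_signalNorm hw] with r hr hrs
    exact (S.disturbanceL.le_opNorm _).trans (by gcongr; exact hr (hsub hrs))
  obtain ⟨ζ, hc, h0, hζ⟩ := exists_integral_solution hL hm hK z₀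
  refine ⟨ζ, ⟨hc, fun t ht => ?_⟩, h0⟩
  rw [hζ t ht, h0]
  simp only [← Plant.sampledField_eq_add_disturbanceL hFw]

theorem Plant.IsHeldSolution.intervalIntegrable (hFw : S.Fw = 0)
    (hp : ∃ ℓ : ℝ≥0, LipschitzWith ℓ S.p)
    {w : ℝ → Vec nw} (hw : MemLp w ∞ (volume.restrict (Set.Ici (0 : ℝ)))) {s : ℝ} (hs : 0 ≤ s)
    {ζ : ℝ → PairVec nx} (hζ : S.IsHeldSolution G w s ζ) {t : ℝ} (ht : s ≤ t) :
    IntervalIntegrable (fun r => S.sampledField G (observerState (ζ s)) (ζ r) (w r))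
      volume s t := by
  obtain ⟨L, hL⟩ := Plant.exists_lipschitzWith_sampledField (G := G) hFw hp (observerState (ζ s))
  have hsub : Set.Icc s t ⊆ Set.Ici (0 : ℝ) := fun r hr => hs.trans hr.1
  have hci : Set.Icc s t ⊆ Set.Ici s := Set.Icc_subset_Ici_self
  simp only [Plant.sampledField_eq_add_disturbanceL hFw _ _ (w _)]
  refine IntervalIntegrable.add ?_ ?_
  · refine ContinuousOn.intervalIntegrable ?_
    rw [Set.uIcc_of_le ht]
    exact hL.continuous.comp_continuousOn (hζ.1.mono hci)
  · rw [intervalIntegrable_iff_integrableOn_Icc_of_le ht]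
    refine Integrable.mono' (g := fun _ => ‖S.disturbanceL‖ * signalNorm w) (integrable_const _)
      ((S.disturbanceL.continuous.comp_aestronglyMeasurable hw.1).mono_measure
        (Measure.restrict_mono hsub le_rfl)) ?_
    rw [ae_restrict_iff' measurableSet_Icc]
    filter_upwards [ae_norm_le_signalNorm hw] with r hr hrs
    exact (S.disturbanceL.le_opNorm _).trans (by gcongr; exact hr (hsub hrs))

/-- For a short time, a held solution stays close to its initial value. -/
theorem Plant.IsHeldSolution.norm_sub_le (hFw : S.Fw = 0) (hp0 : S.p 0 = 0) {Lf Lb : ℝ≥0}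
    (hf : LipschitzWith Lf (fun z => S.continuousField G z 0))
    (hb : LipschitzWith Lb (S.actuation G)) {τ : ℝ} (hτ : 0 < τ)
    (hτL : 4 * τ * (Lf + Lb * ‖observerStateL nx‖) ≤ 1)
    {w : ℝ → Vec nw} {W : ℝ} (hW : 0 ≤ W) (hw : ∀ᵐ r, r ∈ Set.Ici (0 : ℝ) → ‖w r‖ ≤ W)
    {s : ℝ} (hs : 0 ≤ s) {ζ : ℝ → PairVec nx} (hζ : S.IsHeldSolution G w s ζ) {t : ℝ}
    (hst : s ≤ t) (hts : t ≤ s + τ) :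
    ‖ζ t - ζ s‖ ≤ 4 * τ * (Lf * ‖ζ t‖ + ‖S.disturbanceL‖ * W) := by
  -- The maximal displacement `m` on `[s, t]` bounds itself through the integral equation: the field
  -- is at most `C` there, and `C` is affine in `m`.
  obtain ⟨r₀, hr₀, hmax⟩ := isCompact_Icc.exists_isMaxOn (Set.nonempty_Icc.2 hst)
    (((hζ.1.mono (fun r (hr : r ∈ Set.Icc s t) => hr.1)).sub continuousOn_const).norm :
      ContinuousOn (fun r => ‖ζ r - ζ s‖) (Set.Icc s t))
  set m := ‖ζ r₀ - ζ s‖ with hm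
  have hm' : ∀ r ∈ Set.Icc s t, ‖ζ r - ζ s‖ ≤ m := fun r hr => hmax hr
  set Lo := ‖observerStateL nx‖ with hLo
  set Lj := ‖S.disturbanceL‖ with hLj
  have hLo0 : 0 ≤ Lo := norm_nonneg _
  have hLj0 : 0 ≤ Lj := norm_nonneg _
  have hm0 : 0 ≤ m := norm_nonneg _
  set C := Lf * (‖ζ s‖ + m) + (Lb * (Lo * m) + Lj * W) with hC
  have hC0 : 0 ≤ C := by positivity
  have h1 : m ≤ C * |r₀ - s| := by
    have he : ζ r₀ - ζ s
        = ∫ r in s..r₀, S.sampledField G (observerState (ζ s)) (ζ r) (w r) := by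
      rw [hζ.2 r₀ hr₀.1]
      abel
    rw [hm, he]
    refine intervalIntegral.norm_integral_le_of_norm_le_const_ae ?_
    filter_upwards [hw] with r hr hmem
    rw [Set.uIoc_of_le hr₀.1] at hmem
    have hrI : r ∈ Set.Icc s t := ⟨hmem.1.le, hmem.2.trans hr₀.2⟩
    refine (S.norm_sampledField_le hFw hp0 hf hb _ _ _).trans ?_
    have h2 := hm' r hrI
    have h3 := norm_observerState_sub_le (ζ s) (ζ r)
    rw [norm_sub_rev (ζ s)] at h3
    have h4 : ‖ζ r‖ ≤ ‖ζ s‖ + m := by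
      have := norm_sub_norm_le (ζ r) (ζ s)
      linarith
    have h5 := hr (hs.trans hrI.1)
    rw [hC]
    gcongr
    exact h3.trans (by gcongr)
  have h2 : m ≤ C * τ := by
    refine h1.trans ?_
    rw [abs_of_nonneg (sub_nonneg.2 hr₀.1)]
    have := hr₀.2
    gcongr
    linarith
  -- The estimate is wanted in terms of the current state `ζ t`, where $\dot V$ is evaluated. After
  -- this exchange the terms in `m` on the right total at most `m / 2`, by `hτL`, and are absorbed
  -- on the left.
  have h3 : ‖ζ s‖ ≤ ‖ζ t‖ + m := by
    have h4 := hm' t ⟨hst, le_rfl⟩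
    have h5 := norm_sub_norm_le (ζ s) (ζ t)
    rw [norm_sub_rev] at h5
    linarith
  have h4 : τ * Lf * ‖ζ s‖ ≤ τ * Lf * (‖ζ t‖ + m) := by gcongr
  have h5 : 4 * τ * (Lf + Lb * Lo) * m ≤ 1 * m := by gcongr
  have h6 : 0 ≤ τ * Lb * Lo * m := by positivity
  refine (hm' t ⟨hst, le_rfl⟩).trans ?_
  nlinarith

/-- The sampling error between two triggering times. -/
theorem Plant.IsHeldSolution.norm_observerState_sub_le (hFw : S.Fw = 0) (hp0 : S.p 0 = 0)
    {Lf Lb : ℝ≥0}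
    (hf : LipschitzWith Lf (fun z => S.continuousField G z 0))
    (hb : LipschitzWith Lb (S.actuation G)) {τ σ ε : ℝ} (hτ : 0 < τ) (hσ : 0 ≤ σ) (hε : 0 ≤ ε)
    (hτL : 4 * τ * (Lf + Lb * ‖observerStateL nx‖) ≤ 1)
    {w : ℝ → Vec nw} {W : ℝ} (hW : 0 ≤ W) (hw : ∀ᵐ r, r ∈ Set.Ici (0 : ℝ) → ‖w r‖ ≤ W)
    {s : ℝ} (hs : 0 ≤ s) {ζ : ℝ → PairVec nx} (hζ : S.IsHeldSolution G w s ζ) {t : ℝ}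
    (hst : s ≤ t) (hts : (t : EReal) < nextTrigger τ σ ε s ζ) :
    ‖observerState (ζ s) - observerState (ζ t)‖
      ≤ ‖observerStateL nx‖ * (σ + 4 * τ * Lf) * ‖ζ t‖
        + (ε + 4 * τ * ‖observerStateL nx‖ * ‖S.disturbanceL‖ * W) := by
  -- During the dwell time the displacement estimate applies; after it, a violated threshold at `t`
  -- would make the next triggering time at most `t`.
  rcases le_total t (s + τ) with h | h
  · have h1 := hζ.norm_sub_le hFw hp0 hf hb hτ hτL hW hw hs hst h
    have h2 := _root_.norm_observerState_sub_le (ζ s) (ζ t)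
    rw [norm_sub_rev (ζ s)] at h2
    have h3 : ‖observerStateL nx‖ * ‖ζ t - ζ s‖
        ≤ ‖observerStateL nx‖ * (4 * τ * (Lf * ‖ζ t‖ + ‖S.disturbanceL‖ * W)) := by gcongr
    have h4 : 0 ≤ ‖observerStateL nx‖ * σ * ‖ζ t‖ := by positivity
    nlinarith
  · have h1 : ¬ (σ * ‖observerState (ζ t)‖ + ε < ‖observerState (ζ s) - observerState (ζ t)‖) := by
      intro h1
      exact absurd hts (not_lt.2 (sInf_le ⟨t, ⟨h, h1⟩, rfl⟩))
    have h2 : σ * ‖observerState (ζ t)‖ ≤ σ * (‖observerStateL nx‖ * ‖ζ t‖) := by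
      gcongr
      exact norm_observerState_le _
    have h3 : 0 ≤ ‖observerStateL nx‖ * (4 * τ * Lf) * ‖ζ t‖ := by positivity
    have h4 : 0 ≤ 4 * τ * ‖observerStateL nx‖ * ‖S.disturbanceL‖ * W := by positivity
    nlinarith [not_lt.1 h1]

end HeldSolutions

/-! ### Trajectories of the event-triggered closed loop -/

section Trajectories

variable {nx nu ny nq np nw : ℕ} {S : Plant nx nu ny nq np nw} {G : Gains nx nu ny nq np}

theorem add_le_nextTrigger {n : ℕ} (τ σ ε s : ℝ) (ζ : ℝ → PairVec n) :
    ((s + τ : ℝ) : EReal) ≤ nextTrigger τ σ ε s ζ := by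
  refine le_sInf ?_
  rintro _ ⟨t, ht, rfl⟩
  exact EReal.coe_le_coe_iff.2 ht.1

/-- Triggering times are at least `τ` apart. -/
theorem mul_le_of_add_le {T : ℕ → EReal} {τ : ℝ} (h0 : T 0 = 0)
    (htop : ∀ k, T k = ⊤ → T (k + 1) = ⊤)
    (hstep : ∀ (k : ℕ) (s : ℝ), T k = (s : EReal) → ((s + τ : ℝ) : EReal) ≤ T (k + 1)) (k : ℕ) :
    ((k * τ : ℝ) : EReal) ≤ T k := by
  induction k with
  | zero => simp [h0]
  | succ k ih =>
    by_cases hk : T k = ⊤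
    · rw [htop k hk]
      exact le_top
    · have hbot : T k ≠ ⊥ := (lt_of_lt_of_le (EReal.bot_lt_coe _) ih).ne'
      lift T k to ℝ using ⟨hk, hbot⟩ with s hs
      refine le_trans ?_ (hstep k s hs.symm)
      rw [EReal.coe_le_coe_iff] at ih ⊢
      push_cast
      linarith

/-- No Zeno behaviour: the spacing `τ` drives the triggering times past every finite time. -/
theorem exists_lt_of_mul_le {T : ℕ → EReal} {τ : ℝ} (hτ : 0 < τ)
    (h : ∀ k : ℕ, ((k * τ : ℝ) : EReal) ≤ T k) (t : ℝ) : ∃ k, (t : EReal) < T (k + 1) := by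
  obtain ⟨k, hk⟩ := exists_nat_gt (t / τ)
  refine ⟨k, lt_of_lt_of_le (EReal.coe_lt_coe_iff.2 ?_) (h (k + 1))⟩
  rw [div_lt_iff₀ hτ] at hk
  push_cast
  linarith

theorem Plant.IsTriggeredTrajectory.mul_le {τ σ ε : ℝ} {w : ℝ → Vec nw} {T : ℕ → EReal}
    {z : ℝ → PairVec nx} (h : S.IsTriggeredTrajectory G τ σ ε w T z) (k : ℕ) :
    ((k * τ : ℝ) : EReal) ≤ T k := by
  refine mul_le_of_add_le h.start h.stop_of_top (fun k s hs => ?_) k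
  obtain ⟨ζ, -, h2, -⟩ := h.step k s hs
  rw [h2]
  exact add_le_nextTrigger _ _ _ _ _

theorem Plant.IsTriggeredTrajectory.nonneg {τ σ ε : ℝ} (hτ : 0 < τ) {w : ℝ → Vec nw}
    {T : ℕ → EReal} {z : ℝ → PairVec nx} (h : S.IsTriggeredTrajectory G τ σ ε w T z) {k : ℕ}
    {s : ℝ} (hs : T k = s) : 0 ≤ s := by
  have h1 := h.mul_le k
  rw [hs, EReal.coe_le_coe_iff] at h1
  exact le_trans (by positivity) h1

/-- Every time lies in a sampling interval. -/
theorem Plant.IsTriggeredTrajectory.exists_mem {τ σ ε : ℝ} (hτ : 0 < τ) {w : ℝ → Vec nw}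
    {T : ℕ → EReal} {z : ℝ → PairVec nx} (h : S.IsTriggeredTrajectory G τ σ ε w T z) {t : ℝ}
    (ht : 0 ≤ t) : ∃ (k : ℕ) (s : ℝ), T k = s ∧ s ≤ t ∧ (t : EReal) < T (k + 1) := by
  classical
  have hex := exists_lt_of_mul_le hτ h.mul_le t
  have hlt := Nat.find_spec hex
  have hle : T (Nat.find hex) ≤ (t : EReal) := by
    rcases Nat.eq_zero_or_pos (Nat.find hex) with h0 | hpos
    · rw [h0, h.start]
      exact_mod_cast ht
    · have := Nat.find_min hex (Nat.sub_lt hpos one_pos)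
      rw [Nat.sub_one_add_one hpos.ne'] at this
      exact not_lt.1 this
  have hbot : T (Nat.find hex) ≠ ⊥ :=
    (lt_of_lt_of_le (EReal.bot_lt_coe _) (h.mul_le _)).ne'
  have htop : T (Nat.find hex) ≠ ⊤ := (lt_of_le_of_lt hle (EReal.coe_lt_top t)).ne
  have hcoe := EReal.coe_toReal htop hbot
  refine ⟨Nat.find hex, (T (Nat.find hex)).toReal, hcoe.symm, ?_, hlt⟩
  rw [← hcoe] at hle
  exact EReal.coe_le_coe_iff.1 hle

/-- From every initial state there is a trajectory of the event-triggered closed loop. -/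
theorem Plant.exists_isTriggeredTrajectory (hFw : S.Fw = 0)
    (hp : ∃ ℓ : ℝ≥0, LipschitzWith ℓ S.p) {τ : ℝ} (hτ : 0 < τ) (σ ε : ℝ)
    {w : ℝ → Vec nw} (hw : MemLp w ∞ (volume.restrict (Set.Ici (0 : ℝ)))) (z₀ : PairVec nx) :
    ∃ (z : ℝ → PairVec nx) (T : ℕ → EReal), S.IsTriggeredTrajectory G τ σ ε w T z ∧
      z 0 = z₀ := by
  classical
  have hex : ∀ (s : ℝ) (y : PairVec nx), ∃ ζ, ζ s = y ∧ (0 ≤ s → S.IsHeldSolution G w s ζ) := by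
    intro s y
    by_cases hs : 0 ≤ s
    · obtain ⟨ζ, h1, h2⟩ := Plant.exists_isHeldSolution (G := G) hFw hp hw hs y
      exact ⟨ζ, h2, fun _ => h1⟩
    · exact ⟨fun _ => y, rfl, fun h => absurd h hs⟩
  choose H hH0 hH using hex
  -- The recursion carries a triggering time and the state there. If the next time is `⊤`, its
  -- `toReal` is `0` and the recorded state is meaningless, but it is never used since the recursion
  -- then freezes.
  let nextState : EReal × PairVec nx → EReal × PairVec nx := fun q =>
    if q.1 = ⊤ then q else
      (nextTrigger τ σ ε q.1.toReal (H q.1.toReal q.2),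
        H q.1.toReal q.2 (nextTrigger τ σ ε q.1.toReal (H q.1.toReal q.2)).toReal)
  let Q : ℕ → EReal × PairVec nx := fun k => nextState^[k] (0, z₀)
  have hQs : ∀ k, Q (k + 1) = nextState (Q k) := fun k => Function.iterate_succ_apply' _ _ _
  have hQr : ∀ (k : ℕ) (s : ℝ), (Q k).1 = s → Q (k + 1) =
      (nextTrigger τ σ ε s (H s (Q k).2),
        H s (Q k).2 (nextTrigger τ σ ε s (H s (Q k).2)).toReal) := by
    intro k s hs
    rw [hQs]
    simp only [nextState, hs, EReal.coe_ne_top, if_false, EReal.toReal_coe]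
  have htop : ∀ k, (Q k).1 = ⊤ → (Q (k + 1)).1 = ⊤ := by
    intro k hk
    rw [hQs]
    simp only [nextState, hk, if_true]
  have hadd : ∀ (k : ℕ) (s : ℝ), (Q k).1 = (s : EReal) →
      ((s + τ : ℝ) : EReal) ≤ (Q (k + 1)).1 := by
    intro k s hs
    rw [hQr k s hs]
    exact add_le_nextTrigger _ _ _ _ _
  have hmul : ∀ k : ℕ, ((k * τ : ℝ) : EReal) ≤ (Q k).1 :=
    mul_le_of_add_le (T := fun k => (Q k).1) rfl htop hadd
  have hmono : Monotone fun k => (Q k).1 := by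
    refine monotone_nat_of_le_succ fun k => ?_
    by_cases hk : (Q k).1 = ⊤
    · rw [htop k hk]
      exact le_top
    · have hbot : (Q k).1 ≠ ⊥ := (lt_of_lt_of_le (EReal.bot_lt_coe _) (hmul k)).ne'
      have hcoe := EReal.coe_toReal hk hbot
      rw [← hcoe]
      refine le_trans ?_ (hadd k _ hcoe.symm)
      exact EReal.coe_le_coe_iff.2 (by linarith)
  have hfind : ∀ t : ℝ, ∃ k, (t : EReal) < (Q (k + 1)).1 :=
    exists_lt_of_mul_le (T := fun k => (Q k).1) hτ hmul
  let z : ℝ → PairVec nx := fun t =>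
    H (Q (Nat.find (hfind t))).1.toReal (Q (Nat.find (hfind t))).2 t
  have hz : ∀ (k : ℕ) (s t : ℝ), (Q k).1 = s → s ≤ t → (t : EReal) < (Q (k + 1)).1 →
      z t = H s (Q k).2 t := by
    intro k s t hs hst hlt
    have hk : Nat.find (hfind t) = k := by
      rw [Nat.find_eq_iff]
      refine ⟨hlt, fun j hj => not_lt.2 ((hmono (Nat.succ_le_of_lt hj)).trans ?_)⟩
      simp only [hs]
      exact EReal.coe_le_coe_iff.2 hst
    simp only [z, hk, hs, EReal.toReal_coe]
  refine ⟨z, fun k => (Q k).1, ⟨rfl, htop, fun k s hs => ?_⟩, ?_⟩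
  · have hs0 : 0 ≤ s := by
      have := hmul k
      rw [hs, EReal.coe_le_coe_iff] at this
      exact le_trans (by positivity) this
    refine ⟨H s (Q k).2, hH s _ hs0, by simp only [hQr k s hs], fun t hst hle => ?_⟩
    rcases hle.lt_or_eq with hlt | heq
    · exact hz k s t hs hst hlt
    -- At `t = T (k + 1)` the curve `z` already follows the next held solution, which starts from
    -- the final value of the previous one.
    · have h1 : (Q (k + 1)).2 = H s (Q k).2 t := by
        have hq := hQr k s hs
        have h2 : nextTrigger τ σ ε s (H s (Q k).2) = t := by
          rw [heq, hq]
        rw [hq]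
        simp only [h2, EReal.toReal_coe]
      have h3 : (t : EReal) < (Q (k + 1 + 1)).1 := by
        refine lt_of_lt_of_le ?_ (hadd (k + 1) t heq.symm)
        exact EReal.coe_lt_coe_iff.2 (by linarith)
      rw [hz (k + 1) t t heq.symm le_rfl h3, hH0, h1]
  · have h3 : ((0 : ℝ) : EReal) < (Q (0 + 1)).1 := by
      refine lt_of_lt_of_le ?_ (hadd 0 0 rfl)
      exact EReal.coe_lt_coe_iff.2 (by linarith)
    rw [hz 0 0 0 rfl le_rfl h3, hH0]
    rfl

end Trajectories

/-! ### Linear comparison functions -/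

theorem isClassKInf_const_mul {κ : ℝ≥0} (hκ : 0 < κ) : IsClassKInf fun r => κ * r where
  continuous := by fun_prop
  strictMono := fun _ _ h => mul_lt_mul_of_pos_left h hκ
  map_zero := mul_zero _
  tendsto_atTop := tendsto_id.const_mul_atTop hκ

theorem isClassKL_exp_mul {κ : ℝ≥0} (hκ : 0 < κ) {c : ℝ} (hc : 0 < c) :
    IsClassKL fun r t => κ * (Real.exp (-(c * t))).toNNReal * r where
  continuous := by
    unfold Function.uncurry
    fun_prop
  classKInf := fun s =>
    isClassKInf_const_mul (mul_pos hκ (Real.toNNReal_pos.2 (Real.exp_pos _)))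
  antitone := fun r s t hst => by
    have : (s : ℝ) ≤ t := hst
    dsimp only
    gcongr
  tendsto_zero := fun r => by
    have h1 : Tendsto (fun t : ℝ≥0 => Real.exp (-(c * t))) atTop (𝓝 0) :=
      Real.tendsto_exp_neg_atTop_nhds_zero.comp
        ((NNReal.tendsto_coe_atTop.2 tendsto_id).const_mul_atTop hc)
    have h2 := ((continuous_real_toNNReal.tendsto 0).comp h1).const_mul κ |>.mul_const r
    simpa using h2

theorem isPosDefFun_const_mul_sq {κ : ℝ≥0} (hκ : 0 < κ) : IsPosDefFun fun r => κ * r ^ 2 where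
  continuous := by fun_prop
  map_zero := by simp
  pos := fun r hr => by positivity

/-! ### Decay of the Lyapunov function -/

section Decay

variable {nx nu ny nq np nw : ℕ} {S : Plant nx nu ny nq np nw} {G : Gains nx nu ny nq np}
  {P : Matrix (Fin nx ⊕ Fin nx) (Fin nx ⊕ Fin nx) ℝ}

theorem Plant.derivAlong_sampledField_le (hFw : S.Fw = 0) {Lb : ℝ≥0}
    (hb : LipschitzWith Lb (S.actuation G)) {α₀ : ℝ}
    (hV : ∀ z : PairVec nx,
      derivAlong (quadForm P) z (S.continuousField G z 0) ≤ -α₀ * quadForm P z)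
    (xs : Vec nx) (z : PairVec nx) (w : Vec nw) :
    derivAlong (quadForm P) z (S.sampledField G xs z w) ≤ -α₀ * quadForm P z
      + 2 * ‖quadFormL P‖ * ‖z‖
        * (Lb * ‖xs - observerState z‖ + ‖S.disturbanceL‖ * ‖w‖) := by
  rw [S.sampledField_eq G hFw, add_assoc]
  set v := S.actuation G xs - S.actuation G (observerState z) + S.disturbanceL w with hv
  have h1 : derivAlong (quadForm P) z (S.continuousField G z 0 + v)
      = derivAlong (quadForm P) z (S.continuousField G z 0) + derivAlong (quadForm P) z v :=
    map_add _ _ _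
  have h2 := (le_abs_self _).trans ((quadFormL P).le_opNorm₂ z v)
  have h3 := (le_abs_self _).trans ((quadFormL P).le_opNorm₂ v z)
  have h4 : 2 * ‖quadFormL P‖ * ‖z‖ * ‖v‖ ≤ 2 * ‖quadFormL P‖ * ‖z‖
      * (Lb * ‖xs - observerState z‖ + ‖S.disturbanceL‖ * ‖w‖) := by
    gcongr
    exact S.norm_actuation_add_disturbanceL_le hb _ _ _
  rw [h1, derivAlong_quadForm P z v]
  have h5 := hV z
  linarith

/-- Between two triggering times, the derivative of `V` is that of the continuous-time loop up to
a small quadratic term and a term of first order. -/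
theorem Plant.IsHeldSolution.derivAlong_le (hFw : S.Fw = 0) (hp0 : S.p 0 = 0)
    {Lf Lb : ℝ≥0}
    (hf : LipschitzWith Lf (fun z => S.continuousField G z 0))
    (hb : LipschitzWith Lb (S.actuation G)) {α₀ : ℝ}
    (hV : ∀ z : PairVec nx,
      derivAlong (quadForm P) z (S.continuousField G z 0) ≤ -α₀ * quadForm P z)
    {τ σ ε : ℝ} (hτ : 0 < τ) (hσ : 0 ≤ σ) (hε : 0 ≤ ε)
    (hτL : 4 * τ * (Lf + Lb * ‖observerStateL nx‖) ≤ 1) {a : ℝ}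
    (ha : 2 * ‖quadFormL P‖ * (Lb * (‖observerStateL nx‖ * (σ + 4 * τ * Lf))) ≤ a / 4)
    {w : ℝ → Vec nw} {W : ℝ} (hW : 0 ≤ W) (hw : ∀ᵐ r, r ∈ Set.Ici (0 : ℝ) → ‖w r‖ ≤ W)
    {s : ℝ} (hs : 0 ≤ s) {ζ : ℝ → PairVec nx} (hζ : S.IsHeldSolution G w s ζ) {t : ℝ}
    (hst : s ≤ t) (hts : (t : EReal) < nextTrigger τ σ ε s ζ) (v : Vec nw) :
    derivAlong (quadForm P) (ζ t) (S.sampledField G (observerState (ζ s)) (ζ t) v)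
      ≤ -α₀ * quadForm P (ζ t) + a / 4 * ‖ζ t‖ ^ 2 + 2 * ‖quadFormL P‖ * ‖ζ t‖ *
        (Lb * (ε + 4 * τ * ‖observerStateL nx‖ * ‖S.disturbanceL‖ * W)
          + ‖S.disturbanceL‖ * ‖v‖) := by
  have h1 := S.derivAlong_sampledField_le hFw hb hV (observerState (ζ s)) (ζ t) v
  have h2 := hζ.norm_observerState_sub_le hFw hp0 hf hb hτ hσ hε hτL hW hw hs hst hts
  have h3 : 2 * ‖quadFormL P‖ * ‖ζ t‖
        * (Lb * ‖observerState (ζ s) - observerState (ζ t)‖ + ‖S.disturbanceL‖ * ‖v‖)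
      ≤ 2 * ‖quadFormL P‖ * ‖ζ t‖
        * (Lb * (‖observerStateL nx‖ * (σ + 4 * τ * Lf) * ‖ζ t‖
        + (ε + 4 * τ * ‖observerStateL nx‖ * ‖S.disturbanceL‖ * W)) + ‖S.disturbanceL‖ * ‖v‖) := by
    gcongr
  have h4 := mul_le_mul_of_nonneg_right ha (sq_nonneg ‖ζ t‖)
  refine h1.trans ?_
  linarith

/-- Exponential decay of `V`, up to a constant, along the trajectories. -/
theorem Plant.IsTriggeredTrajectory.quadForm_sub_le_exp_mul (hFw : S.Fw = 0) (hp0 : S.p 0 = 0)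
    (hp : ∃ ℓ : ℝ≥0, LipschitzWith ℓ S.p) {τ σ ε c D : ℝ} (hτ : 0 < τ)
    {w : ℝ → Vec nw} (hw : MemLp w ∞ (volume.restrict (Set.Ici (0 : ℝ))))
    {T : ℕ → EReal} {z : ℝ → PairVec nx} (h : S.IsTriggeredTrajectory G τ σ ε w T z)
    (hdec : ∀ (s : ℝ) (ζ : ℝ → PairVec nx), 0 ≤ s → S.IsHeldSolution G w s ζ →
      ∀ᵐ t, s ≤ t → (t : EReal) < nextTrigger τ σ ε s ζ →
        derivAlong (quadForm P) (ζ t) (S.sampledField G (observerState (ζ s)) (ζ t) (w t))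
          ≤ -c * (quadForm P (ζ t) - D)) {t : ℝ} (ht : 0 ≤ t) :
    quadForm P (z t) - D ≤ Real.exp (-c * t) * (quadForm P (z 0) - D) := by
  -- Including the right endpoint lets consecutive intervals be joined. The decay hypothesis may
  -- fail at that one instant, a null set.
  have hstep : ∀ (k : ℕ) (s t : ℝ), T k = s → s ≤ t → (t : EReal) ≤ T (k + 1) →
      quadForm P (z t) - D ≤ Real.exp (-c * (t - s)) * (quadForm P (z s) - D) := by
    intro k s t hk hst htT
    have hs := h.nonneg hτ hk
    obtain ⟨ζ, hζ, hT, hzζ⟩ := h.step k s hk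
    have hsT : (s : EReal) ≤ T (k + 1) := (EReal.coe_le_coe_iff.2 hst).trans htT
    rw [hzζ t hst htT, hzζ s le_rfl hsT]
    obtain ⟨Lf, hf⟩ := S.exists_lipschitzWith_continuousField G hFw hp
    obtain ⟨Lb, hb⟩ := S.exists_lipschitzWith_actuation G hp
    obtain ⟨R, hR⟩ := isCompact_Icc.exists_bound_of_continuousOn
      (hζ.1.mono (fun r (hr : r ∈ Set.Icc s t) => hr.1))
    have hne : ∀ᵐ r : ℝ, r ≠ t := by simp [ae_iff, measure_singleton]
    have key := quadratic_sub_le_exp_mul (quadFormL P) (ζ := ζ) (c := c) (D := D)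
      (f := fun r => S.sampledField G (observerState (ζ s)) (ζ r) (w r))
      (K := Lf * R + (Lb * (‖observerStateL nx‖ * (R + R)) + ‖S.disturbanceL‖ * signalNorm w))
      hst (hζ.intervalIntegrable hFw hp hw hs hst) ?_ (fun r hr => hζ.2 r hr.1) ?_
    · simpa only [quadFormL_apply_self] using key
    · filter_upwards [ae_norm_le_signalNorm hw] with r hr hm
      refine (S.norm_sampledField_le hFw hp0 hf hb _ _ _).trans ?_
      have h1 := hR r hm
      have h2 := hR s ⟨le_rfl, hst⟩
      have h3 := hr (hs.trans hm.1)
      gcongr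
      refine (norm_observerState_sub_le _ _).trans ?_
      gcongr
      exact (norm_sub_le _ _).trans (add_le_add h2 h1)
    · filter_upwards [hdec s ζ hs hζ, hne] with r hr hrt hm
      have h1 : (r : EReal) < nextTrigger τ σ ε s ζ := by
        rw [← hT]
        exact lt_of_lt_of_le (EReal.coe_lt_coe_iff.2 (lt_of_le_of_ne hm.2 hrt)) htT
      have h2 := hr hm.1 h1
      rwa [derivAlong_quadForm, ← quadFormL_apply_self] at h2
  -- The offset `D` is common to all intervals, so the exponential factors simply multiply.
  have hchain : ∀ (k : ℕ) (s : ℝ), T k = s →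
      quadForm P (z s) - D ≤ Real.exp (-c * s) * (quadForm P (z 0) - D) := by
    intro k
    induction k with
    | zero =>
      intro s hs
      rw [h.start] at hs
      have : s = 0 := by exact_mod_cast hs.symm
      simp [this]
    | succ k ih =>
      intro t htk
      have htop : T k ≠ ⊤ := fun h1 => by
        have := h.stop_of_top k h1
        rw [htk] at this
        exact EReal.coe_ne_top _ this
      have hbot : T k ≠ ⊥ := (lt_of_lt_of_le (EReal.bot_lt_coe _) (h.mul_le k)).ne'
      have hcoe := (EReal.coe_toReal htop hbot).symm
      obtain ⟨ζ, -, hT, -⟩ := h.step k _ hcoe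
      have hle := add_le_nextTrigger τ σ ε (T k).toReal ζ
      rw [← hT, htk, EReal.coe_le_coe_iff] at hle
      have h1 := hstep k _ t hcoe (by linarith) htk.ge
      refine h1.trans ?_
      have h2 := mul_le_mul_of_nonneg_left (ih _ hcoe)
        (Real.exp_pos (-c * (t - (T k).toReal))).le
      rw [← mul_assoc, ← Real.exp_add] at h2
      convert h2 using 3
      ring
  obtain ⟨k, s, hk, hst, hlt⟩ := h.exists_mem hτ ht
  refine (hstep k s t hk hst hlt.le).trans ?_
  have h2 := mul_le_mul_of_nonneg_left (hchain k s hk) (Real.exp_pos (-c * (t - s))).le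
  rw [← mul_assoc, ← Real.exp_add] at h2
  convert h2 using 3
  ring

/-- Between triggering times, `V' ≤ -α V + (αl/4) ‖z‖² + (ρ₀ + ρ₁ ‖w‖_∞ + ρ₂ ‖w‖) ‖z‖`. -/
def Plant.DecaysBetweenTriggers (S : Plant nx nu ny nq np nw) (G : Gains nx nu ny nq np)
    (P : Matrix (Fin nx ⊕ Fin nx) (Fin nx ⊕ Fin nx) ℝ) (τ σ ε : ℝ) (α l ρ₀ ρ₁ ρ₂ : ℝ≥0) : Prop :=
  ∀ (w : ℝ → Vec nw) (W : ℝ≥0), (∀ᵐ r, r ∈ Set.Ici (0 : ℝ) → ‖w r‖ ≤ W) →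
    ∀ (s : ℝ) (ζ : ℝ → PairVec nx), 0 ≤ s → S.IsHeldSolution G w s ζ →
    ∀ t, s ≤ t → (t : EReal) < nextTrigger τ σ ε s ζ →
      derivAlong (quadForm P) (ζ t) (S.sampledField G (observerState (ζ s)) (ζ t) (w t))
        ≤ -α * quadForm P (ζ t) + α * l / 4 * ‖ζ t‖ ^ 2 + (ρ₀ + ρ₁ * W + ρ₂ * ‖w t‖) * ‖ζ t‖

theorem tendsto_quadForm_cobounded {n : ℕ} {P : Matrix (Fin n ⊕ Fin n) (Fin n ⊕ Fin n) ℝ}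
    {l : ℝ} (hl : 0 < l) (h : ∀ z, l * ‖z‖ ^ 2 ≤ quadForm P z) :
    Tendsto (quadForm P) (Bornology.cobounded (PairVec n)) atTop :=
  tendsto_atTop_mono h (((tendsto_pow_atTop two_ne_zero).comp
    tendsto_norm_cobounded_atTop).const_mul_atTop hl)

theorem le_add_of_mul_sq_le {l x p q : ℝ} (hl : 0 < l) (hp : 0 ≤ p) (hq : 0 ≤ q)
    (h : l * x ^ 2 ≤ l * p ^ 2 + l * q ^ 2) : x ≤ p + q := by
  rw [← mul_add] at h
  have h1 := le_of_mul_le_mul_left h hl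
  refine le_of_sq_le_sq ?_ (by positivity)
  have := mul_nonneg hp hq
  linarith [add_sq p q]

/-- Young's inequality, with the weight that uses up a further quarter of the decay. -/
theorem mul_le_quarter_mul_sq_add {a : ℝ} (ha : 0 < a) (R x : ℝ) :
    R * x ≤ a / 4 * x ^ 2 + R ^ 2 / a := by
  have h1 : a / 4 * x ^ 2 + R ^ 2 / a - R * x = (a / 2 * x - R) ^ 2 / a := by
    field_simp
    ring
  have h2 : 0 ≤ (a / 2 * x - R) ^ 2 / a := by positivity
  linarith

theorem exists_pos_mul_le_one {X Y : ℝ} (hX : 0 ≤ X) (hY : 0 ≤ Y) :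
    ∃ τ : ℝ, 0 < τ ∧ τ * X ≤ 1 ∧ τ * Y ≤ 1 := by
  refine ⟨1 / (X + Y + 1), by positivity, ?_, ?_⟩ <;>
  · rw [one_div_mul_eq_div, div_le_one (by positivity)]
    linarith

/-- The practical stability estimate for the trajectories under one disturbance. -/
theorem Plant.DecaysBetweenTriggers.norm_le (hFw : S.Fw = 0) (hp0 : S.p 0 = 0)
    (hp : ∃ ℓ : ℝ≥0, LipschitzWith ℓ S.p) {τ σ ε : ℝ} (hτ : 0 < τ) {α l ρ₀ ρ₁ ρ₂ : ℝ≥0}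
    (hα : 0 < α) (hl : 0 < l) (hlP : ∀ z, l * ‖z‖ ^ 2 ≤ quadForm P z)
    (hdec : S.DecaysBetweenTriggers G P τ σ ε α l ρ₀ ρ₁ ρ₂) {w : ℝ → Vec nw}
    (hw : MemLp w ∞ (volume.restrict (Set.Ici (0 : ℝ)))) {T : ℕ → EReal} {z : ℝ → PairVec nx}
    (h : S.IsTriggeredTrajectory G τ σ ε w T z) {t : ℝ} (ht : 0 ≤ t) :
    ‖z t‖ ≤ √2 / (α * l) * (ρ₀ + (ρ₁ + ρ₂) * signalNorm w)
      + √((‖quadFormL P‖ + 1) / l) * Real.exp (-(α / 4 * t)) * ‖z 0‖ := by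
  have hα' : (0 : ℝ) < α := hα
  have hl' : (0 : ℝ) < l := hl
  set W := signalNorm w
  have hwW := ae_norm_le_signalNorm hw
  set R : ℝ := ρ₀ + (ρ₁ + ρ₂) * W with hR
  have hR0 : 0 ≤ R := by positivity
  -- Young's inequality gives $\dot V\le-\alpha V+\frac{\alpha l}{2}\|z\|^2+R^2/(\alpha
  -- l)\le-\frac{\alpha}{2}V+R^2/(\alpha l)$, and `D` is the level at which the last expression
  -- vanishes.
  set D : ℝ := l * (√2 / (α * l) * R) ^ 2 with hD
  have hD0 : 0 ≤ D := by positivity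
  have hD' : α / 2 * D = R ^ 2 / (α * l) := by
    rw [hD, mul_pow, div_pow, Real.sq_sqrt zero_le_two]
    field_simp
  have hdecay := h.quadForm_sub_le_exp_mul (P := P) (c := α / 2) (D := D) hFw hp0 hp hτ hw ?_ ht
  · refine le_add_of_mul_sq_le hl' (by positivity) (by positivity) ?_
    rw [← hD]
    have h2 : quadForm P (z 0) ≤ (‖quadFormL P‖ + 1) * ‖z 0‖ ^ 2 := by
      rw [← quadFormL_apply_self]
      have h3 := (le_abs_self _).trans ((quadFormL P).le_opNorm₂ (z 0) (z 0))
      have h4 := sq_nonneg ‖z 0‖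
      linarith
    have h3 : l * (√((‖quadFormL P‖ + 1) / l) * Real.exp (-(α / 4 * t)) * ‖z 0‖) ^ 2
        = Real.exp (-(α / 2) * t) * ((‖quadFormL P‖ + 1) * ‖z 0‖ ^ 2) := by
      have he : Real.exp (-(α / 4 * t)) ^ 2 = Real.exp (-(α / 2) * t) := by
        rw [← Real.exp_nat_mul]
        congr 1
        push_cast
        ring
      rw [mul_pow, mul_pow, Real.sq_sqrt (by positivity), he]
      field_simp
    rw [h3]
    have hE := Real.exp_pos (-(α / 2) * t)
    have h4 := mul_le_mul_of_nonneg_left h2 hE.le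
    have h5 := mul_nonneg hE.le hD0
    have h6 := hlP (z t)
    linarith
  · intro s ζ hs hζ
    filter_upwards [hwW] with r hr hsr hlt
    have h1 := hdec w W hwW s ζ hs hζ r hsr hlt
    have h2 : (ρ₀ + ρ₁ * W + ρ₂ * ‖w r‖) * ‖ζ r‖ ≤ R * ‖ζ r‖ := by
      have h3 : ρ₂ * ‖w r‖ ≤ ρ₂ * W := by
        gcongr
        exact hr (hs.trans hsr)
      gcongr
      linarith
    have h3 := mul_le_quarter_mul_sq_add (mul_pos hα' hl') R ‖ζ r‖
    have h4 := mul_le_mul_of_nonneg_left (hlP (ζ r)) (by positivity : (0 : ℝ) ≤ α / 2)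
    linarith

theorem Plant.DecaysBetweenTriggers.isISpS (hFw : S.Fw = 0) (hp0 : S.p 0 = 0)
    (hp : ∃ ℓ : ℝ≥0, LipschitzWith ℓ S.p) {τ σ ε : ℝ} (hτ : 0 < τ) {α l ρ₀ ρ₁ ρ₂ : ℝ≥0}
    (hα : 0 < α) (hl : 0 < l) (hlP : ∀ z, l * ‖z‖ ^ 2 ≤ quadForm P z)
    (hdec : S.DecaysBetweenTriggers G P τ σ ε α l ρ₀ ρ₁ ρ₂) (ω₀ : ℝ) :
    IsISpS (fun w z => ∃ T : ℕ → EReal, S.IsTriggeredTrajectory G τ σ ε w T z)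
      (boundedSignals nw ω₀) := by
  have hα' : (0 : ℝ) < α := hα
  -- The summands `+ 1` keep both gains strictly increasing when `‖quadFormL P‖` or `ρ₁ + ρ₂` is
  -- zero. The rate `α / 4` is half that of `V`, which is quadratic in the state.
  refine ⟨fun r t => NNReal.sqrt ((‖quadFormL P‖₊ + 1) / l)
      * (Real.exp (-((α / 4 : ℝ) * t))).toNNReal * r,
    fun r => (NNReal.sqrt 2 / (α * l) * (ρ₁ + ρ₂) + 1) * r, NNReal.sqrt 2 / (α * l) * ρ₀,
    isClassKL_exp_mul (NNReal.sqrt_pos.2 (by positivity)) (by positivity),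
    (isClassKInf_const_mul (by positivity)).toIsClassK, fun w hw => ⟨fun z₀ => ?_, ?_⟩⟩
  · obtain ⟨z, T, h, h0⟩ := Plant.exists_isTriggeredTrajectory (G := G) hFw hp hτ σ ε hw.1 z₀
    exact ⟨z, ⟨T, h⟩, h0⟩
  · rintro z ⟨T, h⟩ t
    have h1 := hdec.norm_le hFw hp0 hp hτ hα hl hlP hw.1 h t.2
    rw [← NNReal.coe_le_coe]
    push_cast
    rw [Real.coe_toNNReal _ (Real.exp_pos _).le]
    refine h1.trans ?_
    have h2 : (0 : ℝ) ≤ signalNorm w := (signalNorm w).2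
    change _ * (_ + _ * (signalNorm w : ℝ)) + _ * Real.exp (-(α / 4 * (t : ℝ))) * _ ≤ _
    linarith

/-- Beyond the threshold the linear term costs at most $\frac{\alpha l}{4}\|z\|^2$, so of the decay
$\alpha l\|z\|^2$ one half survives. The dwell-time error depends on the past of `w`, which
$\|w(t)\|$ does not control; it is bounded through `ω₀` and put into the constant. -/
theorem Plant.DecaysBetweenTriggers.isISpSLyapunov {τ σ ε : ℝ} (hτ : 0 < τ)
    {α l ρ₀ ρ₁ ρ₂ : ℝ≥0}
    (hα : 0 < α) (hl : 0 < l) (hlP : ∀ z, l * ‖z‖ ^ 2 ≤ quadForm P z)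
    (hdec : S.DecaysBetweenTriggers G P τ σ ε α l ρ₀ ρ₁ ρ₂) (ω₀ : ℝ≥0) :
    S.IsISpSLyapunov G τ σ ε (boundedSignals nw ω₀) (quadForm P) := by
  have hα' : (0 : ℝ) < α := hα
  have hl' : (0 : ℝ) < l := hl
  refine ⟨contDiff_quadForm P, by simp [quadForm], fun z hz => ?_,
    tendsto_quadForm_cobounded hl' hlP, fun r => α * l / 2 * r ^ 2,
    fun r => (4 / (α * l) * ρ₂ + 1) * r, 4 / (α * l) * (ρ₀ + ρ₁ * ω₀),
    isPosDefFun_const_mul_sq (by positivity),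
    (isClassKInf_const_mul (by positivity)).toIsClassK, ?_⟩
  · have h1 := norm_pos_iff.2 hz
    exact lt_of_lt_of_le (by positivity) (hlP z)
  · intro w hw T z h k s t hk hst hlt hlarge
    obtain ⟨ζ, hζ, hT, hzζ⟩ := h.step k s hk
    have hsT : (s : EReal) ≤ T (k + 1) := (EReal.coe_le_coe_iff.2 hst).trans hlt.le
    have hww : ∀ᵐ r, r ∈ Set.Ici (0 : ℝ) → ‖w r‖ ≤ ω₀ := by
      filter_upwards [ae_norm_le_signalNorm hw.1] with r hr hm using (hr hm).trans hw.2
    have h1 := hdec w ω₀ hww s ζ (h.nonneg hτ hk) hζ t hst (hT ▸ hlt)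
    rw [hzζ t hst hlt.le] at hlarge ⊢
    rw [hzζ s le_rfl hsT]
    rw [← NNReal.coe_le_coe] at hlarge
    push_cast at hlarge ⊢
    have h2 : 4 / (α * l) * (ρ₀ + ρ₁ * ω₀ + ρ₂ * ‖w t‖) ≤ ‖ζ t‖ := by
      have := norm_nonneg (w t)
      linarith
    have h3 : ρ₀ + ρ₁ * ω₀ + ρ₂ * ‖w t‖ ≤ α * l / 4 * ‖ζ t‖ := by
      have h4 := mul_le_mul_of_nonneg_left h2 (by positivity : (0 : ℝ) ≤ α * l / 4)
      refine le_trans (le_of_eq ?_) h4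
      field_simp
    have h5 := mul_le_mul_of_nonneg_right h3 (norm_nonneg (ζ t))
    have h6 := mul_le_mul_of_nonneg_left (hlP (ζ t)) hα'.le
    refine h1.trans ?_
    linarith

/-- Suitable triggering parameters exist. -/
theorem Plant.exists_decaysBetweenTriggers (hFw : S.Fw = 0) (hp0 : S.p 0 = 0)
    (hp : ∃ ℓ : ℝ≥0, LipschitzWith ℓ S.p) {α l : ℝ≥0} (hα : 0 < α) (hl : 0 < l)
    (hV : ∀ z : PairVec nx,
      derivAlong (quadForm P) z (S.continuousField G z 0) ≤ -α * quadForm P z) :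
    ∃ τ σ ε : ℝ, 0 < τ ∧ 0 < σ ∧ 0 < ε ∧
      ∃ ρ₀ ρ₁ ρ₂ : ℝ≥0, S.DecaysBetweenTriggers G P τ σ ε α l ρ₀ ρ₁ ρ₂ := by
  obtain ⟨Lf, hf⟩ := S.exists_lipschitzWith_continuousField G hFw hp
  obtain ⟨Lb, hb⟩ := S.exists_lipschitzWith_actuation G hp
  set N := 2 * ‖quadFormL P‖₊
  set Lo := ‖observerStateL nx‖₊
  set Lj := ‖S.disturbanceL‖₊
  have hN' : 2 * ‖quadFormL P‖ = N := rfl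
  have hLo : ‖observerStateL nx‖ = Lo := rfl
  have hLj : ‖S.disturbanceL‖ = Lj := rfl
  have ha : (0 : ℝ) < α * l := mul_pos (NNReal.coe_pos.2 hα) (NNReal.coe_pos.2 hl)
  -- `X` secures the displacement estimate. `Y`, and `X` in the choice of `σ` below, allot $\alpha
  -- l/8$ each to the dwell-time and threshold parts of the quadratic error.
  obtain ⟨τ, hτ, hτ1, hτ2⟩ := exists_pos_mul_le_one (X := 4 * (Lf + Lb * Lo))
    (Y := 32 * (N * (Lb * (Lo * Lf))) / (α * l)) (by positivity) (by positivity)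
  obtain ⟨σ, hσ, hσ1, -⟩ := exists_pos_mul_le_one (X := 8 * (N * (Lb * Lo)) / (α * l)) (Y := 0)
    (by positivity) le_rfl
  lift τ to ℝ≥0 using hτ.le
  -- Any positive `ε` would do: it enters only the constant `ρ₀`, here with `ε = 1`. None of the
  -- parameters depends on the bound on `w`.
  refine ⟨τ, σ, 1, hτ, hσ, one_pos, N * Lb, N * (Lb * (4 * τ * Lo * Lj)), N * Lj, ?_⟩
  intro w W hw s ζ hs hζ t hst hlt
  rw [← mul_div_assoc, div_le_one ha] at hτ2 hσ1
  have h := hζ.derivAlong_le hFw hp0 hf hb hV hτ hσ.le zero_le_one (a := α * l)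
    (by rw [hLo]; linarith) (by rw [hN', hLo]; linarith) W.coe_nonneg hw hs hst hlt (w t)
  rw [hN', hLo, hLj] at h
  refine h.trans (le_of_eq ?_)
  push_cast
  ring

end Decay

theorem mainTheorem5 {nx nu ny nq np nw : ℕ}
    (S : Plant nx nu ny nq np nw)
    (M : Matrix (Fin nq ⊕ Fin np) (Fin nq ⊕ Fin np) ℝ)
    (hM : IsIncrementalMultiplier S.p M)
    (hp0 : S.p 0 = 0)
    (hpLip : ∃ ℓ : ℝ≥0, LipschitzWith ℓ S.p)
    (hFw : S.Fw = 0)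
    (ω₀ : ℝ) (hω₀ : 0 < ω₀)
    (G : Gains nx nu ny nq np)
    (P : Matrix (Fin nx ⊕ Fin nx) (Fin nx ⊕ Fin nx) ℝ) (hP : P.PosDef)
    (α₀ : ℝ) (hα₀ : 0 < α₀)
    (hV : ∀ z : PairVec nx,
      derivAlong (quadForm P) z (S.continuousField G z 0) ≤ -α₀ * quadForm P z) :
    ∃ τ σ ε : ℝ, 0 < τ ∧ 0 < σ ∧ 0 < ε ∧
      IsISpS (fun w z => ∃ T : ℕ → EReal, S.IsTriggeredTrajectory G τ σ ε w T z)
        (boundedSignals nw ω₀) ∧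
      S.IsISpSLyapunov G τ σ ε (boundedSignals nw ω₀) (quadForm P) := by
  obtain ⟨l, hl, hlP⟩ := exists_mul_sq_le_quadForm hP
  lift l to ℝ≥0 using hl.le
  lift α₀ to ℝ≥0 using hα₀.le
  lift ω₀ to ℝ≥0 using hω₀.le
  obtain ⟨τ, σ, ε, hτ, hσ, hε, ρ₀, ρ₁, ρ₂, hdec⟩ :=
    Plant.exists_decaysBetweenTriggers (G := G) hFw hp0 hpLip hα₀ hl hV
  exact ⟨τ, σ, ε, hτ, hσ, hε, hdec.isISpS hFw hp0 hpLip hτ hα₀ hl hlP ω₀,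
    hdec.isISpSLyapunov hτ hα₀ hl hlP ω₀⟩
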